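/- **Setting.** Let $a,b\ge 0$ be integers, $d=a+b$, and let $\mathcal X\subset\mathbb R^{a}\times\mathbb R^{b}=\mathbb R^d$ be compact, with points written $(u,z)$. For $s,L>0$ and $\ell=\lfloor s\rfloor$ the Hölder class $\Sigma(s,L)$ consists of the functions $f$ on $\mathcal X$ that have derivatives up to order $\ell$ relative to $\mathcal X$ with $|D^rf(x)-D^rf(y)|\le L\|x-y\|^{s-\ell}$ for all $x,y\in\mathcal X$ and $|r|=\ell$; and $\Sigma(s,L,B',B)=\{f\in\Sigma(s,L): B'<f<B \text{ on }\mathcal X\}$. Let $B'>0$, $s>d/2$, $\alpha\in\mathbb R\setminus\{0,1\}$, and let $p=p_{XZ}$, $q=p_{YZ}$ be probability densities (with respect to Lebesgue measure on $\mathcal X$) in $\Sigma(s,L,B',B)$ with $p\ne q$ on a set of positive measure. Put $$T(p,q)=\frac1{1-\alpha}+\frac1{\alpha-1}\int_{\mathcal X}p^\alpha q^{1-\alpha},$$ $$\psi_{XZ}(v)=\frac{\alpha}{\alpha-1}\Big(p^{\alpha-1}(v)q^{1-\alpha}(v)-\int_{\mathcal X} p^\alpha q^{1-\alpha}\Big),\qquad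 \psi_{YZ}(w)=-\Big(p^{\alpha}(w)q^{-\alpha}(w)-\int_{\mathcal X} p^\alpha q^{1-\alpha}\Big).$$ Let $V_1,V_2,\dots\sim p$ and $W_1,W_2,\dots\sim q$ be random points, all independent, and let the sample sizes $n,m\to\infty$ with $n/(n+m)\to\zeta\in(0,1)$. **Data-split estimator.** Given density estimators $\hat p,\hat q$ (functions of the sample), split $V_1,\dots,V_n$ into its first $\lfloor n/2\rfloor$ and its remaining points, and likewise $W_1,\dots,W_m$. Let $\hat p^{(1)},\hat q^{(1)}$ be computed from the first halves and put $$\hat T^{(1)}=\frac1{1-\alpha}+\frac{\alpha}{\alpha-1}\,\underset{V_i \text{ in the second half}}{\mathrm{mean}}\Big(\frac{\hat p^{(1)}(V_i)}{\hat q^{(1)}(V_i)}\Big)^{\alpha-1}-\underset{W_j \text{ in the second half}}{\mathrm{mean}}\Big(\frac{\hat p^{(1)}(W_j)}{\hat q^{(1)}(W_j)}\Big)^{\alpha};$$ $\hat T^{(2)}$ is obtained by swapping the halves, and $\hat T_{DS}=(\hat T^{(1)}+\hat T^{(2)})/2$. **Claim.** Let $$\sigma^2=\frac1\zeta\,\mathrm{Var}_{p}\,[\psi_{XZ}(V)]+\frac1{1-\zeta}\,\mathrm{Var}_{q}\,[\psi_{YZ}(W)].$$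 Then $\sigma^2>0$, and $$\sqrt{n+m}\,\big(\hat T_{DS}-T(p,q)\big)\ \xrightarrow{\ d\ }\ \mathcal N(0,\sigma^2)$$ in each of the following two cases. 1. $\mathcal X$ is convex, and $\hat p,\hat q$ are kernel density estimators $\frac1{kh^d}\sum_{i\le k}K_{h,t}\big(\frac{t-X_i}{h}\big)$ truncated to $[B',B]$, with bandwidths $h=h_k>0$, $h_k\in\Theta(k^{-1/(2s+d)})$ for sample size $k$ (kernels and bandwidths may differ for $p$ and $q$). Here $K_{h,t}$ is a smoothing kernel of order $\lfloor s\rfloor$ on $\mathcal X$, which may be adapted to the boundary: it is measurable in $(t,u)$, and for some $h_0>0$, $M$, all $0<h\le h_0$ and all $t\in\mathcal X$, integrating over $\{u:t-hu\in\mathcal X\}$, one has $\int K_{h,t}=1$, $\int u^rK_{h,t}(u)\,du=0$ for $1\le|r|\le\lfloor s\rfloor$, $\int K_{h,t}^2\le M$ and $\int\|u\|^s|K_{h,t}(u)|\,du\le M$. 2. $\mathcal X$ is any compact set, and $\hat p,\hat q$ are any measurable density estimators with values in $[B',B]$ on $\mathcal X$ whose mean integrated squared errors at $p$ and $q$, from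 $k$ observations, satisfy $\mathbb E\|\hat p-p\|_{L_2(\mathcal X)}^2,\ \mathbb E\|\hat q-q\|_{L_2(\mathcal X)}^2\in O(k^{-2s/(2s+d)})$. Moreover, if $p$ and $q$ have the same $Z$-marginal $p_Z$ (almost everywhere), then $T(p,q)$ is the conditional Tsallis divergence $$T(p,q)=\int p_Z(z)\,\frac1{\alpha-1}\Big(\int p_{X|Z}^{\alpha}(u,z)\,p_{Y|Z}^{1-\alpha}(u,z)\,du-1\Big)dz .$$ -/

import Mathlib

open MeasureTheory ProbabilityTheory Filter Asymptotics
open scoped Topology ENNReal NNReal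

noncomputable section

namespace CondTsallis

/-- The Euclidean space `ℝ^ι` (with its Euclidean norm and Lebesgue measure). -/
abbrev Euc (ι : Type) [Fintype ι] : Type := EuclideanSpace ℝ ι

section General

variable {ι : Type} [Fintype ι]

/-- The Hölder class `Σ(s, L)` on `X ⊆ ℝ^ι`: with `ℓ = ⌊s⌋`, the function `f` has derivatives
`F · 0 = f, F · 1, …, F · ℓ` relative to `X`, and every partial derivative of order `ℓ` satisfies
`|D^r f(x) - D^r f(y)| ≤ L ‖x - y‖^(s-ℓ)` on `X`.  A partial derivative of order `ℓ` is the value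
of the `ℓ`-th derivative at a word `c` of `ℓ` coordinate directions; `r_i` is the number of
occurrences of `i` in `c`.  On a convex body `F` is determined by `f`. -/
def HolderClass (X : Set (Euc ι)) (s L : ℝ) : Set (Euc ι → ℝ) :=
  {f | ∃ F : Euc ι → FormalMultilinearSeries ℝ (Euc ι) ℝ,
      HasFTaylorSeriesUpToOn (⌊s⌋₊ : ℕ) f F X ∧
      ∀ c : Fin ⌊s⌋₊ → ι, ∀ x ∈ X, ∀ y ∈ X,
        |F x ⌊s⌋₊ (fun j => EuclideanSpace.basisFun ι ℝ (c j)) -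
          F y ⌊s⌋₊ (fun j => EuclideanSpace.basisFun ι ℝ (c j))| ≤
            L * ‖x - y‖ ^ (s - (⌊s⌋₊ : ℝ))}

/-- The bounded Hölder class `Σ(s, L, B', B)`: members of `Σ(s, L)` with `B' < f < B` on `X`. -/
def BoundedHolderClass (X : Set (Euc ι)) (s L B' B : ℝ) : Set (Euc ι → ℝ) :=
  {f | f ∈ HolderClass X s L ∧ ∀ x ∈ X, B' < f x ∧ f x < B}

/-- The measure on `ℝ^ι` carried by `X` with Lebesgue density `f` there. -/
def densityLaw (X : Set (Euc ι)) (f : Euc ι → ℝ) : Measure (Euc ι) :=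
  (volume.restrict X).withDensity (fun x => ENNReal.ofReal (f x))

/-! ### The functional and its influence functions -/

/-- The integral `∫ p^α q^(1-α)` over `X`. -/
def powerIntegral (X : Set (Euc ι)) (α : ℝ) (p q : Euc ι → ℝ) : ℝ :=
  ∫ x in X, p x ^ α * q x ^ (1 - α)

/-- The conditional Tsallis divergence in terms of the joint densities `p = p_XZ`, `q = p_YZ`. -/
def tsallis (X : Set (Euc ι)) (α : ℝ) (p q : Euc ι → ℝ) : ℝ :=
  1 / (1 - α) + 1 / (α - 1) * powerIntegral X α p q

/-- The influence function with respect to the first density. -/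
def psiXZ (X : Set (Euc ι)) (α : ℝ) (p q : Euc ι → ℝ) (v : Euc ι) : ℝ :=
  α / (α - 1) * (p v ^ (α - 1) * q v ^ (1 - α) - powerIntegral X α p q)

/-- The influence function with respect to the second density; the exponent `-α` is
`(1 - α) - 1`. -/
def psiYZ (X : Set (Euc ι)) (α : ℝ) (p q : Euc ι → ℝ) (w : Euc ι) : ℝ :=
  -(p w ^ α * q w ^ (-α) - powerIntegral X α p q)

/-- `ζ⁻¹ Var_p ψ_XZ(V; p, q) + (1 - ζ)⁻¹ Var_q ψ_YZ(W; p, q)`. -/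
def asympVar (X : Set (Euc ι)) (α ζ : ℝ) (p q : Euc ι → ℝ) : ℝ :=
  1 / ζ * variance (psiXZ X α p q) (densityLaw X p) +
    1 / (1 - ζ) * variance (psiYZ X α p q) (densityLaw X q)

/-! ### The data-split estimator -/

/-- A density estimator: for every sample size `k`, a function of the sample and of the point. -/
abbrev DensityEstimator (ι : Type) [Fintype ι] : Type :=
  (k : ℕ) → (Fin k → Euc ι) → Euc ι → ℝ

/-- The first `⌊n/2⌋` points of the sample `v 0, …, v (n-1)`. -/
def firstHalf (n : ℕ) (v : ℕ → Euc ι) : Fin (n / 2) → Euc ι := fun i => v i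

/-- The remaining `n - ⌊n/2⌋` points of the sample `v 0, …, v (n-1)`. -/
def secondHalf (n : ℕ) (v : ℕ → Euc ι) : Fin (n - n / 2) → Euc ι := fun i => v (n / 2 + i)

/-- The preliminary estimator, with density estimates `f`, `g` and averages over `v`, `w`. -/
def prelim (α : ℝ) (f g : Euc ι → ℝ) {k l : ℕ} (v : Fin k → Euc ι) (w : Fin l → Euc ι) : ℝ :=
  1 / (1 - α) + α / (α - 1) * ((1 / (k : ℝ)) * ∑ i, (f (v i) / g (v i)) ^ (α - 1)) -
    (1 / (l : ℝ)) * ∑ j, (f (w j) / g (w j)) ^ α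

/-- The data-split estimator from `v 0, …, v (n-1)` and `w 0, …, w (m-1)`: densities are estimated
on one half of each sample and averages are taken over the other half, the halves are swapped, and
the two results are averaged. -/
def dsEstimator (α : ℝ) (phat qhat : DensityEstimator ι) (n m : ℕ) (v w : ℕ → Euc ι) : ℝ :=
  (prelim α (phat _ (firstHalf n v)) (qhat _ (firstHalf m w)) (secondHalf n v) (secondHalf m w) +
    prelim α (phat _ (secondHalf n v)) (qhat _ (secondHalf m w)) (firstHalf n v) (firstHalf m w))
    / 2

/-- `√(n+m) (T̂_DS - T(p, q))` converges in law to `N(0, σ²)` along the sample sizes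
`n = n_k`, `m = m_k`, where `σ²` is `asympVar`. -/
def DSAsympNormal {Ω : Type*} [MeasurableSpace Ω] (P : Measure Ω) [IsProbabilityMeasure P]
    (V W : ℕ → Ω → Euc ι) (n m : ℕ → ℕ) (X : Set (Euc ι)) (α ζ : ℝ) (p q : Euc ι → ℝ)
    (phat qhat : DensityEstimator ι) : Prop :=
  TendstoInDistribution
    (fun (k : ℕ) (ω : Ω) => √((n k + m k : ℕ) : ℝ) *
      (dsEstimator α phat qhat (n k) (m k) (fun i => V i ω) (fun j => W j ω) - tsallis X α p q))
    atTop (fun x : ℝ => x) (fun _ => P) (gaussianReal 0 (asympVar X α ζ p q).toNNReal)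

/-! ### Density estimators -/

/-- A (measurable) density estimator with values in `[B', B]` on `X`. -/
structure IsBoundedEstimator (X : Set (Euc ι)) (B' B : ℝ) (phat : DensityEstimator ι) : Prop where
  measurable : ∀ k, Measurable (fun a : (Fin k → Euc ι) × Euc ι => phat k a.1 a.2)
  bounds : ∀ k v, ∀ x ∈ X, B' ≤ phat k v x ∧ phat k v x ≤ B

/-- The estimator attains at `p` the mean integrated squared error rate `k^(-2s/(2s+d))`. -/
def AttainsRate (X : Set (Euc ι)) (s : ℝ) (p : Euc ι → ℝ) (phat : DensityEstimator ι) : Prop :=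
  (fun k : ℕ => ∫ v, (∫ x in X, (phat k v x - p x) ^ 2)
      ∂(Measure.pi (fun _ : Fin k => densityLaw X p)))
    =O[atTop] fun k : ℕ => (k : ℝ) ^ (-(2 * s) / (2 * s + Fintype.card ι))

/-- The kernel density estimate `(k h^d)⁻¹ ∑ K((t - X_i) / h)`; the kernel may depend on the
bandwidth `h` and on the point `t`, as is needed near the boundary of `X`. -/
def kde (K : ℝ → Euc ι → Euc ι → ℝ) (h : ℝ) {k : ℕ} (v : Fin k → Euc ι) (t : Euc ι) : ℝ :=
  1 / ((k : ℝ) * h ^ Fintype.card ι) * ∑ i, K h t (h⁻¹ • (t - v i))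

/-- The kernel density estimator with bandwidths `h k`, truncated at `B'` and `B`. -/
def truncKDE (K : ℝ → Euc ι → Euc ι → ℝ) (h : ℕ → ℝ) (B' B : ℝ) : DensityEstimator ι :=
  fun k v t => max B' (min B (kde K (h k) v t))

/-- `K` is a smoothing kernel for smoothness `s` on `X`: for all small `h` and all `t ∈ X`,
relative to the points `u` with `t - h u ∈ X`, the kernel `K h t` has integral one, its
moments of orders `1, …, ⌊s⌋` vanish, and `∫ K²` and `∫ ‖u‖^s |K|` are bounded.
If `K h t = K₀` and the ball of radius `R h` around `t` lies in `X`, where `K₀` is supported in the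
ball of radius `R`, these are the usual conditions on a kernel `K₀` of order `⌊s⌋`. -/
structure IsSmoothingKernel (X : Set (Euc ι)) (s : ℝ) (K : ℝ → Euc ι → Euc ι → ℝ) : Prop where
  measurable : ∀ h, Measurable (fun a : Euc ι × Euc ι => K h a.1 a.2)
  moments : ∃ h₀ > 0, ∃ M : ℝ, ∀ h, 0 < h → h ≤ h₀ → ∀ t ∈ X,
    IntegrableOn (fun u => K h t u ^ 2) {u | t - h • u ∈ X} ∧
    ∫ u in {u | t - h • u ∈ X}, K h t u ^ 2 ≤ M ∧
    IntegrableOn (fun u => ‖u‖ ^ s * |K h t u|) {u | t - h • u ∈ X} ∧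
    ∫ u in {u | t - h • u ∈ X}, ‖u‖ ^ s * |K h t u| ≤ M ∧
    ∫ u in {u | t - h • u ∈ X}, K h t u = 1 ∧
    ∀ r : ι → ℕ, 1 ≤ ∑ i, r i → ∑ i, r i ≤ ⌊s⌋₊ →
      ∫ u in {u | t - h • u ∈ X}, (∏ i, u i ^ r i) * K h t u = 0

end General

/-! ### The conditional form of the divergence -/

section Conditional

variable {a b : ℕ}

/-- The point `(u, z)` of `ℝ^a × ℝ^b = ℝ^(a+b)`. -/
def joint (u : Euc (Fin a)) (z : Euc (Fin b)) : Euc (Fin a ⊕ Fin b) :=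
  WithLp.toLp 2 (Sum.elim (fun i => u i) (fun j => z j))

/-- The `Z`-marginal density of the joint density `p` on `X`. -/
def marginalZ (X : Set (Euc (Fin a ⊕ Fin b))) (p : Euc (Fin a ⊕ Fin b) → ℝ)
    (z : Euc (Fin b)) : ℝ :=
  ∫ u in {u : Euc (Fin a) | joint u z ∈ X}, p (joint u z)

/-- The conditional density at `u` given `z`. -/
def condDensity (X : Set (Euc (Fin a ⊕ Fin b))) (p : Euc (Fin a ⊕ Fin b) → ℝ)
    (u : Euc (Fin a)) (z : Euc (Fin b)) : ℝ :=
  p (joint u z) / marginalZ X p z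

/-- The conditional Tsallis divergence
`∫ p_Z(z) (α-1)⁻¹ (∫ p_{X|Z}^α(u,z) p_{Y|Z}^(1-α)(u,z) du - 1) dz`. -/
def condTsallis (X : Set (Euc (Fin a ⊕ Fin b))) (α : ℝ) (p q : Euc (Fin a ⊕ Fin b) → ℝ) : ℝ :=
  ∫ z : Euc (Fin b), marginalZ X p z * (1 / (α - 1) *
    ((∫ u in {u : Euc (Fin a) | joint u z ∈ X},
      condDensity X p u z ^ α * condDensity X q u z ^ (1 - α)) - 1))

end Conditional

end CondTsallis

end

/-!
Write `T(p, q) = 1 / (1 - α) + (α - 1)⁻¹ ∫ p ^ α q ^ (1 - α)`, and let `T₀` be one half of the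
data-split estimator, with densities `f`, `g` estimated from one half of the data and averages
taken over the other half.

*Von Mises expansion.* The integrand `(x, y) ↦ (α - 1)⁻¹ x ^ α y ^ (1 - α)` is homogeneous of
degree one, so by Euler's identity its linearisation at `(f, g)` is
`(x, y) ↦ x * ∂₁(f, g) + y * ∂₂(f, g)` without a constant term, and the empirical version of the
integral of this linearisation is exactly `T₀ - 1 / (1 - α)`. As all densities lie in `[B', B]`
with `B' > 0`, the second order remainder is at most `C ((f - x) ^ 2 + (g - y) ^ 2)`
(`exists_von_mises_remainder_le`), so given `f` and `g` the bias of `T₀` is bounded by the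
integrated squared errors of `f` and `g` (`exists_abs_bias_le`).

*Data splitting.* Given the half from which `f` and `g` are computed, the other half is still an
independent sample. Replacing the gradient at `(f, g)` by the one at `(p, q)` in the centred
empirical averages therefore costs a term whose conditional second moment is at most a constant
times `1 / k` times the integrated squared errors (`integral_sq_mean_sub_le_of_indepFun`).
Altogether `T₀ - T(p, q)` is a centred average of the influence functions plus an error which is
at most `C (√(MISE / k) + MISE)` in `L¹` (`exists_integral_abs_linRemainder_le`). This is
`o(k ^ (-1/2))` as soon as the mean integrated squared error MISE is, which holds for the rate
`k ^ (-2s / (2s + d))` because `s > d / 2` (`tendsto_sqrt_mul_mise_of_attainsRate`).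

*Limit.* The linear part is a weighted sum over two independent samples. Its characteristic
function is a product of four powers, one for each half of each sample, and each power converges
by the central limit theorem along the sample sizes (`tendstoInDistribution_halves`). The
variances add up to `σ²`. If `σ²` vanished, `(p / q) ^ (α - 1)` would be constant almost
everywhere, and `p = q` almost everywhere as both densities integrate to one (`asympVar_pos`).

*Kernel estimators.* On a convex domain a Hölder function is approximated along segments by its
Taylor polynomial (`exists_taylor_of_mem_holderClass`), whose nonconstant terms are annihilated by
the vanishing moments of the kernel. The squared bias is thus `O(h ^ (2s))` and the variance is
`O(1 / (k h ^ d))`, truncation at `B'` and `B` does not increase the error, and the bandwidth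
`k ^ (-1 / (2s + d))` balances the two terms (`attainsRate_truncKDE`).

*Conditional form.* With a common marginal `m = p_Z`, the product of the conditional densities to
the powers `α` and `1 - α` is `p ^ α q ^ (1 - α) / m`, the weight `m` cancels the denominator, and
Fubini's theorem applies (`condTsallis_eq_tsallis`).
-/

namespace CondTsallis

/-! ### Pointwise inequalities for powers of a ratio -/

lemma exists_lipschitz_rpow {lo hi : ℝ} (hlo : 0 < lo) (β : ℝ) :
    ∃ C, 0 ≤ C ∧ ∀ r ∈ Set.Icc lo hi, ∀ t ∈ Set.Icc lo hi, |r ^ β - t ^ β| ≤ C * |r - t| := by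
  have hc : ContinuousOn (fun x : ℝ => β * x ^ (β - 1)) (Set.Icc lo hi) := by
    refine continuousOn_const.mul (continuousOn_id.rpow_const fun x hx => Or.inl ?_)
    exact (hlo.trans_le hx.1).ne'
  obtain ⟨C, hC⟩ := isCompact_Icc.exists_bound_of_continuousOn hc
  refine ⟨max C 0, le_max_right _ _, fun r hr t ht => ?_⟩
  have := (convex_Icc lo hi).norm_image_sub_le_of_norm_hasDerivWithin_le
    (f := fun x : ℝ => x ^ β) (f' := fun x => β * x ^ (β - 1)) (C := max C 0)
    (fun x hx => (Real.hasDerivAt_rpow_const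
      (Or.inl (hlo.trans_le hx.1).ne')).hasDerivWithinAt)
    (fun x hx => (hC x hx).trans (le_max_left _ _)) ht hr
  simpa [Real.norm_eq_abs] using this

lemma exists_taylor_rpow {lo hi : ℝ} (hlo : 0 < lo) (α : ℝ) :
    ∃ C, 0 ≤ C ∧ ∀ r ∈ Set.Icc lo hi, ∀ t ∈ Set.Icc lo hi,
      |r ^ α - t ^ α - α * t ^ (α - 1) * (r - t)| ≤ C * (r - t) ^ 2 := by
  obtain ⟨C, hC0, hC⟩ := exists_lipschitz_rpow (hi := hi) hlo (α - 1)
  refine ⟨|α| * C, by positivity, fun r hr t ht => ?_⟩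
  have hsub : Set.uIcc t r ⊆ Set.Icc lo hi := Set.uIcc_subset_Icc ht hr
  have := (convex_uIcc t r).norm_image_sub_le_of_norm_hasDerivWithin_le
    (f := fun x : ℝ => x ^ α - t ^ α - α * t ^ (α - 1) * (x - t))
    (f' := fun x => α * x ^ (α - 1) - α * t ^ (α - 1)) (C := |α| * C * |r - t|)
    (fun x hx => by
      have h1 := (Real.hasDerivAt_rpow_const (p := α)
        (Or.inl (hlo.trans_le (hsub hx).1).ne')).hasDerivWithinAt (s := Set.uIcc t r)
      have h2 := ((hasDerivWithinAt_id x (Set.uIcc t r)).sub_const t).const_mul (α * t ^ (α - 1))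
      exact ((h1.sub_const (t ^ α)).fun_sub h2).congr_deriv (by ring))
    (fun x hx => by
      rw [← mul_sub, norm_mul, Real.norm_eq_abs, Real.norm_eq_abs, mul_assoc]
      gcongr
      refine (hC x (hsub hx) t ht).trans ?_
      gcongr C * ?_
      exact Set.abs_sub_left_of_mem_uIcc hx)
    Set.left_mem_uIcc Set.right_mem_uIcc
  simp only [Real.norm_eq_abs, sub_self, mul_zero, sub_zero] at this
  refine this.trans_eq ?_
  rw [mul_assoc, abs_mul_abs_self, sq]

lemma div_mem_Icc {B' B x y : ℝ} (hB' : 0 < B') (hx : x ∈ Set.Icc B' B) (hy : y ∈ Set.Icc B' B) :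
    x / y ∈ Set.Icc (B' / B) (B / B') := by
  have hy0 : 0 < y := hB'.trans_le hy.1
  have hx0 : 0 < x := hB'.trans_le hx.1
  exact ⟨div_le_div₀ hx0.le hx.1 hy0 hy.2, div_le_div₀ (hx0.le.trans hx.2) hx.2 hB' hy.1⟩

lemma sq_div_sub_div_le {B' B x y f g : ℝ} (hB' : 0 < B') (hx : x ∈ Set.Icc B' B)
    (hy : y ∈ Set.Icc B' B) (hg : g ∈ Set.Icc B' B) :
    (x / y - f / g) ^ 2 ≤ 2 * (B / B' ^ 2) ^ 2 * ((f - x) ^ 2 + (g - y) ^ 2) := by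
  have hy0 : 0 < y := hB'.trans_le hy.1
  have hg0 : 0 < g := hB'.trans_le hg.1
  have hB : 0 < B := hy0.trans_le hy.2
  have key : x / y - f / g = (1 / (y * g)) * (x * (g - y) - y * (f - x)) := by
    field_simp
    ring
  have h1 : (1 / (y * g)) ^ 2 ≤ (1 / B' ^ 2) ^ 2 := by
    have : B' ^ 2 ≤ y * g := by nlinarith [hy.1, hg.1]
    gcongr
  have h2 : (x * (g - y) - y * (f - x)) ^ 2 ≤ 2 * B ^ 2 * ((f - x) ^ 2 + (g - y) ^ 2) := by
    have hx2 : x ^ 2 ≤ B ^ 2 := by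
      have := hx.2
      have := hB'.le.trans hx.1
      gcongr
    have hy2 : y ^ 2 ≤ B ^ 2 := by
      have := hy.2
      gcongr
    nlinarith [sq_nonneg (x * (g - y) + y * (f - x)),
      mul_le_mul_of_nonneg_right hx2 (sq_nonneg (g - y)),
      mul_le_mul_of_nonneg_right hy2 (sq_nonneg (f - x))]
  rw [key, mul_pow]
  calc _ ≤ (1 / B' ^ 2) ^ 2 * (2 * B ^ 2 * ((f - x) ^ 2 + (g - y) ^ 2)) := by gcongr
    _ = _ := by ring

/-- The powers of a density ratio that enter the estimator depend on the two densities in a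
Lipschitz way, as long as these keep away from `0` and `∞`. -/
lemma exists_sq_rpow_div_sub_le {B' B : ℝ} (hB' : 0 < B') (β : ℝ) :
    ∃ C, 0 ≤ C ∧ ∀ x ∈ Set.Icc B' B, ∀ y ∈ Set.Icc B' B, ∀ f ∈ Set.Icc B' B, ∀ g ∈ Set.Icc B' B,
      ((f / g) ^ β - (x / y) ^ β) ^ 2 ≤ C * ((f - x) ^ 2 + (g - y) ^ 2) := by
  by_cases hB : 0 < B
  swap
  · exact ⟨0, le_rfl, fun x hx => absurd (hB'.trans_le (hx.1.trans hx.2)) hB⟩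
  obtain ⟨C, hC0, hC⟩ := exists_lipschitz_rpow (lo := B' / B) (hi := B / B') (by positivity) β
  refine ⟨C ^ 2 * (2 * (B / B' ^ 2) ^ 2), by positivity, fun x hx y hy f hf g hg => ?_⟩
  have h1 := hC _ (div_mem_Icc hB' hx hy) _ (div_mem_Icc hB' hf hg)
  calc ((f / g) ^ β - (x / y) ^ β) ^ 2 = |(x / y) ^ β - (f / g) ^ β| ^ 2 := by
        rw [sq_abs]; ring
    _ ≤ (C * |x / y - f / g|) ^ 2 := by gcongr
    _ = C ^ 2 * (x / y - f / g) ^ 2 := by rw [mul_pow, sq_abs]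
    _ ≤ _ := by
        rw [mul_assoc]
        gcongr
        exact sq_div_sub_div_le hB' hx hy hg

/-- The von Mises remainder is of second order.  As `(x, y) ↦ x ^ α * y ^ (1 - α)` is homogeneous of
degree one, the linearisation at `(f, g)` has no constant term, and the remainder is `y` times the
second order Taylor remainder of `r ↦ r ^ α` between the ratios `f / g` and `x / y`. -/
lemma exists_von_mises_remainder_le {B' B : ℝ} (hB' : 0 < B') {α : ℝ} (hα1 : α ≠ 1) :
    ∃ C, 0 ≤ C ∧ ∀ x ∈ Set.Icc B' B, ∀ y ∈ Set.Icc B' B, ∀ f ∈ Set.Icc B' B, ∀ g ∈ Set.Icc B' B,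
      |x * (α / (α - 1) * (f / g) ^ (α - 1)) + y * (-(f / g) ^ α)
          - 1 / (α - 1) * (x ^ α * y ^ (1 - α))| ≤ C * ((f - x) ^ 2 + (g - y) ^ 2) := by
  by_cases hB : 0 < B
  swap
  · exact ⟨0, le_rfl, fun x hx => absurd (hB'.trans_le (hx.1.trans hx.2)) hB⟩
  have hα : α - 1 ≠ 0 := sub_ne_zero.2 hα1
  obtain ⟨C, hC0, hC⟩ := exists_taylor_rpow (lo := B' / B) (hi := B / B') (by positivity) α
  refine ⟨B / |α - 1| * (C * (2 * (B / B' ^ 2) ^ 2)), by positivity,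
    fun x hx y hy f hf g hg => ?_⟩
  have hx0 : 0 < x := hB'.trans_le hx.1
  have hy0 : 0 < y := hB'.trans_le hy.1
  have hf0 : 0 < f := hB'.trans_le hf.1
  have hg0 : 0 < g := hB'.trans_le hg.1
  have h1 := hC _ (div_mem_Icc hB' hx hy) _ (div_mem_Icc hB' hf hg)
  have e1 : x ^ α * y ^ (1 - α) = y * (x / y) ^ α := by
    rw [Real.div_rpow hx0.le hy0.le, Real.rpow_sub hy0, Real.rpow_one]
    ring
  have e2 : (f / g) ^ α = (f / g) * (f / g) ^ (α - 1) := by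
    rw [Real.rpow_sub_one (by positivity)]; field_simp
  have key : x * (α / (α - 1) * (f / g) ^ (α - 1)) + y * (-(f / g) ^ α)
      - 1 / (α - 1) * (x ^ α * y ^ (1 - α)) =
      -(y / (α - 1)) * ((x / y) ^ α - (f / g) ^ α
        - α * (f / g) ^ (α - 1) * (x / y - f / g)) := by
    rw [e1, e2]
    field_simp
    ring
  rw [key, abs_mul, abs_neg, abs_div, abs_of_pos hy0]
  calc _ ≤ B / |α - 1| * (C * (x / y - f / g) ^ 2) := by
        gcongr
        exact hy.2
    _ ≤ B / |α - 1| * (C * (2 * (B / B' ^ 2) ^ 2 * ((f - x) ^ 2 + (g - y) ^ 2))) := by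
        gcongr
        exact sq_div_sub_div_le hB' hx hy hg
    _ = _ := by ring

/-! ### Empirical averages of a random function -/

section EmpiricalMean

variable {E : Type*} [MeasurableSpace E]

lemma integral_sq_mean_sub_le (μ : Measure E) [IsProbabilityMeasure μ] {g : E → ℝ}
    (hg : MemLp g 2 μ) {k : ℕ} (hk : 0 < k) :
    ∫ x, ((1 / (k : ℝ)) * ∑ i, g (x i) - ∫ y, g y ∂μ) ^ 2 ∂(Measure.pi fun _ : Fin k => μ)
      ≤ (1 / (k : ℝ)) * ∫ y, g y ^ 2 ∂μ := by
  have hk' : (k : ℝ) ≠ 0 := by positivity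
  set π := Measure.pi fun _ : Fin k => μ
  have hgi : Integrable g μ := hg.integrable (by norm_num)
  have hmp : ∀ i : Fin k, MeasurePreserving (fun x : Fin k → E => x i) π μ :=
    fun i => measurePreserving_eval _ i
  have hmean : ∫ x, (∑ i, fun x : Fin k → E => g (x i)) x ∂π = k * ∫ y, g y ∂μ := by
    simp only [Finset.sum_apply]
    rw [integral_finsetSum _ fun i _ =>
      show Integrable (fun x => g (x i)) π from (hmp i).integrable_comp_of_integrable hgi]
    have : ∀ i : Fin k, ∫ x, g (x i) ∂π = ∫ y, g y ∂μ := fun i => by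
      rw [← (hmp i).map_eq, integral_map (hmp i).aemeasurable]
      rw [(hmp i).map_eq]
      exact hgi.aestronglyMeasurable
    simp [this]
  have hvar := variance_sum_pi (μ := fun _ : Fin k => μ) (X := fun _ => g) (fun _ => hg)
  have hae : AEMeasurable (∑ i, fun x : Fin k → E => g (x i)) π :=
    Finset.aemeasurable_sum _ fun i _ =>
      ((hmp i).integrable_comp_of_integrable hgi).aemeasurable
  rw [variance_eq_integral hae, hmean] at hvar
  have hle : Var[g; μ] ≤ ∫ y, g y ^ 2 ∂μ := variance_le_expectation_sq hgi.aestronglyMeasurable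
  have e1 : ∀ x : Fin k → E, ((1 / (k : ℝ)) * ∑ i, g (x i) - ∫ y, g y ∂μ) ^ 2 =
      (1 / (k : ℝ) ^ 2) *
        ((∑ i, fun x : Fin k → E => g (x i)) x - k * ∫ y, g y ∂μ) ^ 2 := fun x => by
    simp only [Finset.sum_apply]
    field_simp
  simp_rw [e1]
  rw [integral_const_mul, hvar]
  simp only [Finset.sum_const, Finset.card_univ, Fintype.card_fin, nsmul_eq_mul]
  calc _ = (1 / (k : ℝ)) * Var[g; μ] := by field_simp
    _ ≤ _ := by gcongr

/-- Conditionally on `Z`, the average of the random function `D (Z, ·)` over an independent sample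
has variance at most `1 / k` times its second moment. -/
lemma integral_sq_mean_sub_le_of_indepFun {Ω S : Type*} [MeasurableSpace Ω] [MeasurableSpace S]
    {P : Measure Ω} [IsProbabilityMeasure P] {μ : Measure E} [IsProbabilityMeasure μ]
    {D : S → E → ℝ} (hD : Measurable fun a : S × E => D a.1 a.2) {C : ℝ}
    (hC : ∀ z x, |D z x| ≤ C) {Z : Ω → S} (hZ : Measurable Z) {k : ℕ} (hk : 0 < k)
    {x : Ω → Fin k → E} (hx : HasLaw x (Measure.pi fun _ => μ) P) (hind : IndepFun Z x P) :
    ∫ ω, ((1 / (k : ℝ)) * ∑ i, D (Z ω) (x ω i) - ∫ y, D (Z ω) y ∂μ) ^ 2 ∂P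
      ≤ (1 / (k : ℝ)) * ∫ ω, (∫ y, D (Z ω) y ^ 2 ∂μ) ∂P := by
  have hk' : (0 : ℝ) < k := by positivity
  have hC0 : ∀ z : S, ∀ y : E, D z y ^ 2 ≤ C ^ 2 := fun z y => by
    rw [← sq_abs]
    have := hC z y
    gcongr
  have hDz : ∀ z, Measurable (D z) := fun z => hD.comp measurable_prodMk_left
  have hZp : IsProbabilityMeasure (P.map Z) := Measure.isProbabilityMeasure_map hZ.aemeasurable
  have hlaw : P.map (fun ω => (Z ω, x ω)) = (P.map Z).prod (Measure.pi fun _ => μ) := by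
    rw [hind.map_prod_eq_prod_map_map hZ.aemeasurable hx.aemeasurable, hx.map_eq]
  let H : S × (Fin k → E) → ℝ := fun a =>
    ((1 / (k : ℝ)) * ∑ i, D a.1 (a.2 i) - ∫ y, D a.1 y ∂μ) ^ 2
  have hI : Measurable fun z => ∫ y, D z y ∂μ :=
    (hD.stronglyMeasurable.integral_prod_right (ν := μ)).measurable
  have hI2 : Measurable fun z => ∫ y, D z y ^ 2 ∂μ :=
    ((hD.pow_const 2).stronglyMeasurable.integral_prod_right (ν := μ)).measurable
  have hH : Measurable H := by
    refine ((Measurable.const_mul (Finset.measurable_sum _ fun i _ => ?_) _).sub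
      (hI.comp measurable_fst)).pow_const 2
    exact hD.comp (measurable_fst.prodMk ((measurable_pi_apply i).comp measurable_snd))
  have hHb : ∀ a, ‖H a‖ ≤ (2 * C) ^ 2 := fun a => by
    have h1 : |(1 / (k : ℝ)) * ∑ i, D a.1 (a.2 i)| ≤ C := by
      rw [abs_mul, abs_of_pos (by positivity : 0 < 1 / (k : ℝ))]
      have : |∑ i, D a.1 (a.2 i)| ≤ k * C := by
        refine (Finset.abs_sum_le_sum_abs _ _).trans ?_
        refine (Finset.sum_le_sum fun i _ => hC a.1 (a.2 i)).trans ?_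
        simp
      calc _ ≤ 1 / (k : ℝ) * (k * C) := by gcongr
        _ = C := by field_simp
    have h2 : |∫ y, D a.1 y ∂μ| ≤ C := by
      simpa using norm_integral_le_of_norm_le_const (μ := μ)
        (.of_forall fun y => (Real.norm_eq_abs _).trans_le (hC a.1 y))
    have h3 : |(1 / (k : ℝ)) * ∑ i, D a.1 (a.2 i) - ∫ y, D a.1 y ∂μ| ≤ 2 * C := by
      refine (abs_sub _ _).trans ?_
      linarith
    simp only [H, Real.norm_eq_abs, abs_pow]
    gcongr
  have hHi : Integrable H ((P.map Z).prod (Measure.pi fun _ => μ)) :=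
    .of_bound hH.aestronglyMeasurable _ (.of_forall hHb)
  calc _ = ∫ ω, H (Z ω, x ω) ∂P := rfl
    _ = ∫ a, H a ∂(P.map fun ω => (Z ω, x ω)) := by
        rw [integral_map (hZ.aemeasurable.prodMk hx.aemeasurable) hH.aestronglyMeasurable]
    _ = ∫ z, ∫ y, H (z, y) ∂(Measure.pi fun _ => μ) ∂(P.map Z) := by
        rw [hlaw, integral_prod _ hHi]
    _ ≤ ∫ z, (1 / (k : ℝ)) * ∫ y, D z y ^ 2 ∂μ ∂(P.map Z) := by
        refine integral_mono hHi.integral_prod_left ?_ fun z => ?_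
        · refine .const_mul (.of_bound hI2.aestronglyMeasurable (C ^ 2) (.of_forall fun z => ?_)) _
          have := norm_integral_le_of_norm_le_const (μ := μ) (f := fun y => D z y ^ 2) (C := C ^ 2)
            (.of_forall fun y => by
              rw [Real.norm_of_nonneg (sq_nonneg _)]
              exact hC0 z y)
          simpa using this
        · refine integral_sq_mean_sub_le μ (g := D z) ?_ hk
          exact MemLp.of_bound (hDz z).aestronglyMeasurable C (.of_forall fun y => hC z y)
    _ = _ := by
        rw [integral_const_mul, integral_map hZ.aemeasurable hI2.aestronglyMeasurable]

lemma integral_abs_le_sqrt {Ω : Type*} [MeasurableSpace Ω] {P : Measure Ω}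
    [IsProbabilityMeasure P] {f : Ω → ℝ} (hf : MemLp f 2 P) :
    ∫ ω, |f ω| ∂P ≤ √(∫ ω, f ω ^ 2 ∂P) := by
  refine Real.le_sqrt_of_sq_le ?_
  have h := variance_nonneg |f| P
  rw [variance_eq_sub hf.abs] at h
  simpa using h

end EmpiricalMean

/-! ### The linearised functional and the second order remainder -/

section Linearisation

universe u v

variable {ι : Type} [Fintype ι]

/-- The partial derivative in `x` of `(α - 1)⁻¹ x ^ α y ^ (1 - α)`, evaluated at `(f, g)`. -/
noncomputable def gradFst {E : Type*} (α : ℝ) (f g : E → ℝ) (v : E) : ℝ :=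
  α / (α - 1) * (f v / g v) ^ (α - 1)

/-- The partial derivative in `y` of `(α - 1)⁻¹ x ^ α y ^ (1 - α)`, evaluated at `(f, g)`. -/
noncomputable def gradSnd {E : Type*} (α : ℝ) (f g : E → ℝ) (w : E) : ℝ := -(f w / g w) ^ α

lemma prelim_eq (α : ℝ) (f g : Euc ι → ℝ) {k l : ℕ} (v : Fin k → Euc ι) (w : Fin l → Euc ι) :
    prelim α f g v w = 1 / (1 - α) + (1 / (k : ℝ)) * ∑ i, gradFst α f g (v i)
      + (1 / (l : ℝ)) * ∑ j, gradSnd α f g (w j) := by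
  simp only [prelim, gradFst, gradSnd, ← Finset.mul_sum, Finset.sum_neg_distrib]
  ring

lemma integral_densityLaw {X : Set (Euc ι)} {p : Euc ι → ℝ}
    (hp : AEMeasurable p (volume.restrict X)) (hp0 : ∀ᵐ x ∂volume.restrict X, 0 ≤ p x)
    (φ : Euc ι → ℝ) : ∫ x, φ x ∂densityLaw X p = ∫ x in X, p x * φ x := by
  rw [densityLaw, integral_withDensity_eq_integral_toReal_smul₀ hp.ennreal_ofReal (by simp)]
  refine integral_congr_ae ?_
  filter_upwards [hp0] with x hx
  simp [ENNReal.toReal_ofReal hx]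

lemma isProbabilityMeasure_densityLaw {X : Set (Euc ι)} {p : Euc ι → ℝ}
    (hp0 : ∀ᵐ x ∂volume.restrict X, 0 ≤ p x)
    (hp1 : ∫ x in X, p x = 1) : IsProbabilityMeasure (densityLaw X p) := by
  refine ⟨?_⟩
  have hi : Integrable p (volume.restrict X) := by
    by_contra h
    simp [integral_undef h] at hp1
  rw [densityLaw, withDensity_apply _ MeasurableSet.univ, Measure.restrict_univ,
    ← ofReal_integral_eq_lintegral_ofReal hi hp0, hp1, ENNReal.ofReal_one]

lemma exists_abs_rpow_div_le {B' B : ℝ} (hB' : 0 < B') (β : ℝ) :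
    ∃ C, 0 ≤ C ∧ ∀ x ∈ Set.Icc B' B, ∀ y ∈ Set.Icc B' B, |(x / y) ^ β| ≤ C := by
  by_cases hB : 0 < B
  swap
  · exact ⟨0, le_rfl, fun x hx => absurd (hB'.trans_le (hx.1.trans hx.2)) hB⟩
  have hc : ContinuousOn (fun x : ℝ => x ^ β) (Set.Icc (B' / B) (B / B')) :=
    continuousOn_id.rpow_const fun x hx => Or.inl
      ((by positivity : 0 < B' / B).trans_le hx.1).ne'
  obtain ⟨C, hC⟩ := isCompact_Icc.exists_bound_of_continuousOn hc
  exact ⟨max C 0, le_max_right _ _, fun x hx y hy =>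
    (hC _ (div_mem_Icc hB' hx hy)).trans (le_max_left _ _)⟩

lemma exists_abs_gradFst_le {B' B : ℝ} (hB' : 0 < B') (α : ℝ) :
    ∃ C, 0 ≤ C ∧ ∀ f g : Euc ι → ℝ, ∀ x, f x ∈ Set.Icc B' B → g x ∈ Set.Icc B' B →
      |gradFst α f g x| ≤ C := by
  obtain ⟨C, hC0, hC⟩ := exists_abs_rpow_div_le (B := B) hB' (α - 1)
  refine ⟨|α / (α - 1)| * C, by positivity, fun f g x hf hg => ?_⟩
  rw [gradFst, abs_mul]
  gcongr
  exact hC _ hf _ hg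

lemma exists_abs_gradSnd_le {B' B : ℝ} (hB' : 0 < B') (α : ℝ) :
    ∃ C, 0 ≤ C ∧ ∀ f g : Euc ι → ℝ, ∀ x, f x ∈ Set.Icc B' B → g x ∈ Set.Icc B' B →
      |gradSnd α f g x| ≤ C := by
  obtain ⟨C, hC0, hC⟩ := exists_abs_rpow_div_le (B := B) hB' α
  refine ⟨C, hC0, fun f g x hf hg => ?_⟩
  rw [gradSnd, abs_neg]
  exact hC _ hf _ hg

lemma measurable_gradFst {S : Type*} [MeasurableSpace S] {f g : S → ℝ} (α : ℝ)
    (hf : Measurable f) (hg : Measurable g) : Measurable (gradFst α f g) :=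
  ((hf.div hg).pow_const _).const_mul _

lemma measurable_gradSnd {S : Type*} [MeasurableSpace S] {f g : S → ℝ} (α : ℝ)
    (hf : Measurable f) (hg : Measurable g) : Measurable (gradSnd α f g) :=
  ((hf.div hg).pow_const _).neg

lemma sq_sub_le_sq_sub {B' B x y : ℝ} (hx : x ∈ Set.Icc B' B) (hy : y ∈ Set.Icc B' B) :
    (x - y) ^ 2 ≤ (B - B') ^ 2 := by
  rw [← sq_abs]
  have : |x - y| ≤ B - B' :=
    abs_le.2 ⟨by linarith [hx.1, hy.2], by linarith [hx.2, hy.1]⟩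
  gcongr

lemma integrable_sq_sub {B' B : ℝ} (X : Set (Euc ι)) (hX : volume X ≠ ∞) {u v : Euc ι → ℝ}
    (hu : Measurable u) (hv : Measurable v) (hub : ∀ x, u x ∈ Set.Icc B' B)
    (hvb : ∀ x, v x ∈ Set.Icc B' B) :
    Integrable (fun x => (u x - v x) ^ 2) (volume.restrict X) := by
  have : IsFiniteMeasure (volume.restrict X) := isFiniteMeasure_restrict.2 hX
  refine .of_bound ((hu.sub hv).pow_const 2).aestronglyMeasurable ((B - B') ^ 2)
    (.of_forall fun x => ?_)
  rw [Real.norm_of_nonneg (sq_nonneg _)]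
  exact sq_sub_le_sq_sub (hub x) (hvb x)

/-- The expectation of the linearised estimator with fixed preliminary densities `f`, `g` misses the
functional by an error that is quadratic in the errors of `f` and `g`. -/
lemma exists_abs_bias_le {B' B : ℝ} (hB' : 0 < B') {α : ℝ} (hα1 : α ≠ 1) :
    ∃ C, 0 ≤ C ∧ ∀ X : Set (Euc ι), volume X ≠ ∞ → ∀ p q f g : Euc ι → ℝ,
      Measurable p → Measurable q → Measurable f → Measurable g →
      (∀ x, p x ∈ Set.Icc B' B) → (∀ x, q x ∈ Set.Icc B' B) →
      (∀ x, f x ∈ Set.Icc B' B) → (∀ x, g x ∈ Set.Icc B' B) →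
      |1 / (1 - α) + ∫ x, gradFst α f g x ∂densityLaw X p + ∫ x, gradSnd α f g x ∂densityLaw X q
        - tsallis X α p q| ≤ C * ((∫ x in X, (f x - p x) ^ 2) + ∫ x in X, (g x - q x) ^ 2) := by
  obtain ⟨C, hC0, hC⟩ := exists_von_mises_remainder_le (B := B) hB' hα1
  obtain ⟨C1, hC10, hC1⟩ := exists_abs_gradFst_le (ι := ι) (B := B) hB' α
  obtain ⟨C2, hC20, hC2⟩ := exists_abs_gradSnd_le (ι := ι) (B := B) hB' α
  obtain ⟨C3, hC30, hC3⟩ := exists_abs_rpow_div_le (B := B) hB' α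
  refine ⟨C, hC0, fun X hX p q f g hpm hqm hfm hgm hp hq hf hg => ?_⟩
  have : IsFiniteMeasure (volume.restrict X) := isFiniteMeasure_restrict.2 hX
  have habs : ∀ {x : ℝ}, x ∈ Set.Icc B' B → |x| ≤ B := fun {x} hx =>
    abs_le.2 ⟨by linarith [hx.1, hx.2], hx.2⟩
  have i1 : Integrable (fun x => p x * gradFst α f g x) (volume.restrict X) :=
    .of_bound (hpm.mul (measurable_gradFst α hfm hgm)).aestronglyMeasurable (B * C1)
      (.of_forall fun x => by
        rw [Real.norm_eq_abs, abs_mul]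
        have := habs (hp x)
        have := hC1 f g x (hf x) (hg x)
        have := (abs_nonneg _).trans (habs (hp x))
        gcongr)
  have i2 : Integrable (fun x => q x * gradSnd α f g x) (volume.restrict X) :=
    .of_bound (hqm.mul (measurable_gradSnd α hfm hgm)).aestronglyMeasurable (B * C2)
      (.of_forall fun x => by
        rw [Real.norm_eq_abs, abs_mul]
        have := habs (hq x)
        have := hC2 f g x (hf x) (hg x)
        have := (abs_nonneg _).trans (habs (hp x))
        gcongr)
  have i3 : Integrable (fun x => p x ^ α * q x ^ (1 - α)) (volume.restrict X) :=
    .of_bound ((hpm.pow_const _).mul (hqm.pow_const _)).aestronglyMeasurable (B * C3)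
      (.of_forall fun x => by
        have e : p x ^ α * q x ^ (1 - α) = q x * (p x / q x) ^ α := by
          have hq0 := hB'.trans_le (hq x).1
          rw [Real.div_rpow (hB'.le.trans (hp x).1) hq0.le, Real.rpow_sub hq0, Real.rpow_one]
          ring
        rw [e, Real.norm_eq_abs, abs_mul]
        have := habs (hq x)
        have := hC3 _ (hp x) _ (hq x)
        have := (abs_nonneg _).trans (habs (hp x))
        gcongr)
  rw [integral_densityLaw hpm.aemeasurable (.of_forall fun x => hB'.le.trans (hp x).1),
    integral_densityLaw hqm.aemeasurable (.of_forall fun x => hB'.le.trans (hq x).1), tsallis,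
    powerIntegral]
  have e : 1 / (1 - α) + (∫ x in X, p x * gradFst α f g x) + (∫ x in X, q x * gradSnd α f g x)
      - (1 / (1 - α) + 1 / (α - 1) * ∫ x in X, p x ^ α * q x ^ (1 - α)) =
      ∫ x in X, (p x * gradFst α f g x + q x * gradSnd α f g x
        - 1 / (α - 1) * (p x ^ α * q x ^ (1 - α))) := by
    rw [integral_sub (f := fun x => p x * gradFst α f g x + q x * gradSnd α f g x) (i1.add i2)
      (i3.const_mul _), integral_add i1 i2, integral_const_mul]
    ring
  rw [e, ← Real.norm_eq_abs,
    ← integral_add (integrable_sq_sub X hX hfm hpm hf hp) (integrable_sq_sub X hX hgm hqm hg hq),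
    ← integral_const_mul]
  refine norm_integral_le_of_norm_le (((integrable_sq_sub X hX hfm hpm hf hp).add
    (integrable_sq_sub X hX hgm hqm hg hq)).const_mul C) (.of_forall fun x => ?_)
  exact hC _ (hp x) _ (hq x) _ (hf x) _ (hg x)

/-- The error of one half `prelim α f g v w` of the data-split estimator, after subtraction of the
centred empirical averages of the derivatives of the functional at the true densities. -/
noncomputable def linRemainder (X : Set (Euc ι)) (α : ℝ) (p q f g : Euc ι → ℝ) {k l : ℕ}
    (v : Fin k → Euc ι) (w : Fin l → Euc ι) : ℝ :=
  prelim α f g v w - tsallis X α p q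
    - ((1 / (k : ℝ)) * ∑ i, gradFst α p q (v i) - ∫ t, gradFst α p q t ∂densityLaw X p)
    - ((1 / (l : ℝ)) * ∑ j, gradSnd α p q (w j) - ∫ t, gradSnd α p q t ∂densityLaw X q)

lemma integrable_integral_sq_sub {B' B : ℝ} {X : Set (Euc ι)} (hX : volume X ≠ ∞)
    {Ω S : Type*} [MeasurableSpace Ω] [MeasurableSpace S] (P : Measure Ω) [IsFiniteMeasure P]
    {u : S → Euc ι → ℝ} {v : Euc ι → ℝ} (hu : Measurable fun a : S × Euc ι => u a.1 a.2)
    (hv : Measurable v) (hub : ∀ z x, u z x ∈ Set.Icc B' B) (hvb : ∀ x, v x ∈ Set.Icc B' B)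
    {Z : Ω → S} (hZ : Measurable Z) : Integrable (fun ω => ∫ t in X, (u (Z ω) t - v t) ^ 2) P := by
  have hfin : IsFiniteMeasure (volume.restrict X) := isFiniteMeasure_restrict.2 hX
  have hm : Measurable fun a : S × Euc ι => (u a.1 a.2 - v a.2) ^ 2 :=
    (hu.sub (hv.comp measurable_snd)).pow_const 2
  refine .of_bound (Measurable.aestronglyMeasurable ?_)
    ((B - B') ^ 2 * (volume.restrict X).real Set.univ) (.of_forall fun ω => ?_)
  · exact (hm.stronglyMeasurable.integral_prod_right' (ν := volume.restrict X)).measurable.comp hZ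
  · refine norm_integral_le_of_norm_le_const (.of_forall fun t => ?_)
    rw [Real.norm_of_nonneg (sq_nonneg _)]
    exact sq_sub_le_sq_sub (hub _ t) (hvb t)

/-- If the random function `D (Z, ·)` is controlled by the errors of the density estimates
`f (Z, ·)` and `g (Z, ·)`, so is its centred average over an independent sample. -/
lemma integral_abs_mean_sub_le {B' B : ℝ} (hB' : 0 < B') {X : Set (Euc ι)} (hX : volume X ≠ ∞)
    {p q r : Euc ι → ℝ} (hpm : Measurable p) (hqm : Measurable q) (hrm : Measurable r)
    (hp : ∀ x, p x ∈ Set.Icc B' B) (hq : ∀ x, q x ∈ Set.Icc B' B) (hr : ∀ x, r x ∈ Set.Icc B' B)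
    (hr1 : ∫ x in X, r x = 1)
    {Ω S : Type*} [MeasurableSpace Ω] [MeasurableSpace S] {P : Measure Ω} [IsProbabilityMeasure P]
    {f g : S → Euc ι → ℝ} (hfm : Measurable fun a : S × Euc ι => f a.1 a.2)
    (hgm : Measurable fun a : S × Euc ι => g a.1 a.2) (hf : ∀ z x, f z x ∈ Set.Icc B' B)
    (hg : ∀ z x, g z x ∈ Set.Icc B' B)
    {Z : Ω → S} (hZ : Measurable Z) {k : ℕ} (hk : 0 < k) {x : Ω → Fin k → Euc ι}
    (hxm : Measurable x) (hx : HasLaw x (Measure.pi fun _ => densityLaw X r) P)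
    (hZx : IndepFun Z x P) {D : S → Euc ι → ℝ} (hD : Measurable fun a : S × Euc ι => D a.1 a.2)
    {C₀ C : ℝ} (hDb : ∀ z x, |D z x| ≤ C₀)
    (hDsq : ∀ z x, D z x ^ 2 ≤ C * ((f z x - p x) ^ 2 + (g z x - q x) ^ 2)) :
    Integrable (fun ω => (1 / (k : ℝ)) * ∑ i, D (Z ω) (x ω i)
      - ∫ y, D (Z ω) y ∂densityLaw X r) P ∧
    ∫ ω, |(1 / (k : ℝ)) * ∑ i, D (Z ω) (x ω i) - ∫ y, D (Z ω) y ∂densityLaw X r| ∂P ≤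
      √(1 / (k : ℝ) * (B * C * ∫ ω, ((∫ t in X, (f (Z ω) t - p t) ^ 2)
        + ∫ t in X, (g (Z ω) t - q t) ^ 2) ∂P)) := by
  have hμ : IsProbabilityMeasure (densityLaw X r) :=
    isProbabilityMeasure_densityLaw (.of_forall fun x => hB'.le.trans (hr x).1) hr1
  have hfin : IsFiniteMeasure (volume.restrict X) := isFiniteMeasure_restrict.2 hX
  have hint : Measurable fun z => ∫ y, D z y ∂densityLaw X r :=
    (hD.stronglyMeasurable.integral_prod_right (ν := densityLaw X r)).measurable
  have hM : Measurable (fun ω => (1 / (k : ℝ)) * ∑ i, D (Z ω) (x ω i)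
      - ∫ y, D (Z ω) y ∂densityLaw X r) := by
    refine (Measurable.const_mul (Finset.measurable_sum _ fun i _ => ?_) _).sub (hint.comp hZ)
    exact hD.comp (hZ.prodMk ((measurable_pi_apply i).comp hxm))
  have hMb : MemLp (fun ω => (1 / (k : ℝ)) * ∑ i, D (Z ω) (x ω i)
      - ∫ y, D (Z ω) y ∂densityLaw X r) 2 P := by
    refine .of_bound hM.aestronglyMeasurable (1 / (k : ℝ) * (k * C₀) + C₀)
      (.of_forall fun ω => (norm_sub_le _ _).trans (add_le_add ?_ ?_))
    · rw [norm_mul, Real.norm_of_nonneg (by positivity : 0 ≤ 1 / (k : ℝ))]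
      gcongr
      refine (norm_sum_le _ _).trans ((Finset.sum_le_sum fun i _ => hDb (Z ω) (x ω i)).trans ?_)
      simp
    · simpa using norm_integral_le_of_norm_le_const (μ := densityLaw X r)
        (.of_forall fun y => (Real.norm_eq_abs _).trans_le (hDb (Z ω) y))
  refine ⟨hMb.integrable (by norm_num), (integral_abs_le_sqrt hMb).trans (Real.sqrt_le_sqrt ?_)⟩
  refine (integral_sq_mean_sub_le_of_indepFun hD hDb hZ hk hx hZx).trans ?_
  gcongr
  rw [← integral_const_mul]
  refine integral_mono_of_nonneg (.of_forall fun ω => integral_nonneg fun y => sq_nonneg _)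
    (((integrable_integral_sq_sub hX P hfm hpm hf hp hZ).add
      (integrable_integral_sq_sub hX P hgm hqm hg hq hZ)).const_mul _) (.of_forall fun ω => ?_)
  have i1 := integrable_sq_sub X hX (hfm.comp (measurable_prodMk_left (x := Z ω))) hpm (hf _) hp
  have i2 := integrable_sq_sub X hX (hgm.comp (measurable_prodMk_left (x := Z ω))) hqm (hg _) hq
  simp only [Function.comp_def] at i1 i2
  dsimp only
  rw [integral_densityLaw hrm.aemeasurable (.of_forall fun x => hB'.le.trans (hr x).1),
    ← integral_add i1 i2, ← integral_const_mul]
  refine integral_mono_of_nonneg (.of_forall fun t => mul_nonneg (hB'.le.trans (hr t).1)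
    (sq_nonneg _)) ((i1.add i2).const_mul _) (.of_forall fun t => ?_)
  dsimp only
  rw [mul_assoc]
  have := hB'.le.trans (hr t).1
  exact mul_le_mul (hr t).2 (hDsq _ t) (sq_nonneg _) (this.trans (hr t).2)

/-- One half of the data-split estimator is, up to an error that is small in `L¹`, the empirical
average of the derivatives of the functional at the true densities.  The densities `f (Z, ·)` and
`g (Z, ·)` are estimated from a sample `Z` independent of the samples `x`, `y` averaged over. -/
lemma exists_integral_abs_linRemainder_le {B' B : ℝ} (hB' : 0 < B') {α : ℝ} (hα1 : α ≠ 1) :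
    ∃ C, 0 ≤ C ∧ ∀ X : Set (Euc ι), volume X ≠ ∞ → ∀ p q : Euc ι → ℝ,
      Measurable p → Measurable q →
      (∀ x, p x ∈ Set.Icc B' B) → (∀ x, q x ∈ Set.Icc B' B) →
      (∫ x in X, p x = 1) → (∫ x in X, q x = 1) →
      ∀ {Ω : Type u} {S : Type v} [MeasurableSpace Ω] [MeasurableSpace S] (P : Measure Ω)
        [IsProbabilityMeasure P] (f g : S → Euc ι → ℝ),
      (Measurable fun a : S × Euc ι => f a.1 a.2) → (Measurable fun a : S × Euc ι => g a.1 a.2) →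
      (∀ z x, f z x ∈ Set.Icc B' B) → (∀ z x, g z x ∈ Set.Icc B' B) →
      ∀ (Z : Ω → S) (k l : ℕ) (x : Ω → Fin k → Euc ι) (y : Ω → Fin l → Euc ι),
      Measurable Z → 0 < k → 0 < l → Measurable x → Measurable y →
      HasLaw x (Measure.pi fun _ => densityLaw X p) P →
      HasLaw y (Measure.pi fun _ => densityLaw X q) P →
      IndepFun Z x P → IndepFun Z y P →
      Integrable (fun ω => linRemainder X α p q (f (Z ω)) (g (Z ω)) (x ω) (y ω)) P ∧
      ∀ e : ℝ, ∫ ω, ((∫ t in X, (f (Z ω) t - p t) ^ 2) + ∫ t in X, (g (Z ω) t - q t) ^ 2) ∂P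
        = e →
      ∫ ω, |linRemainder X α p q (f (Z ω)) (g (Z ω)) (x ω) (y ω)| ∂P
        ≤ √(1 / (k : ℝ) * (C * e)) + √(1 / (l : ℝ) * (C * e)) + C * e := by
  obtain ⟨Ca, hCa0, hCa⟩ := exists_sq_rpow_div_sub_le (B := B) hB' (α - 1)
  obtain ⟨Cb, hCb0, hCb⟩ := exists_sq_rpow_div_sub_le (B := B) hB' α
  obtain ⟨C1, hC10, hC1⟩ := exists_abs_gradFst_le (ι := ι) (B := B) hB' α
  obtain ⟨C2, hC20, hC2⟩ := exists_abs_gradSnd_le (ι := ι) (B := B) hB' α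
  obtain ⟨Cr, hCr0, hCr⟩ := exists_abs_bias_le (ι := ι) (B := B) hB' hα1
  refine ⟨|B| * ((α / (α - 1)) ^ 2 * Ca + Cb) + Cr, by positivity, ?_⟩
  intro X hX p q hpm hqm hp hq hp1 hq1 Ω S _ _ P _ f g hfm hgm hf hg Z k l x y hZ hk hl hxm hym
    hx hy hZx hZy
  have hB : 0 < B := hB'.trans_le ((hp 0).1.trans (hp 0).2)
  have hμ : IsProbabilityMeasure (densityLaw X p) :=
    isProbabilityMeasure_densityLaw (.of_forall fun x => hB'.le.trans (hp x).1) hp1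
  have hν : IsProbabilityMeasure (densityLaw X q) :=
    isProbabilityMeasure_densityLaw (.of_forall fun x => hB'.le.trans (hq x).1) hq1
  have hfz : ∀ z, Measurable (f z) := fun z => hfm.comp measurable_prodMk_left
  have hgz : ∀ z, Measurable (g z) := fun z => hgm.comp measurable_prodMk_left
  let D₁ : S → Euc ι → ℝ := fun z t => gradFst α (f z) (g z) t - gradFst α p q t
  let D₂ : S → Euc ι → ℝ := fun z t => gradSnd α (f z) (g z) t - gradSnd α p q t
  have hD₁ : Measurable fun a : S × Euc ι => D₁ a.1 a.2 :=
    (measurable_gradFst α hfm hgm).sub ((measurable_gradFst α hpm hqm).comp measurable_snd)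
  have hD₂ : Measurable fun a : S × Euc ι => D₂ a.1 a.2 :=
    (measurable_gradSnd α hfm hgm).sub ((measurable_gradSnd α hpm hqm).comp measurable_snd)
  have hD₁b : ∀ z t, |D₁ z t| ≤ C1 + C1 := fun z t => (abs_sub _ _).trans
    (add_le_add (hC1 _ _ t (hf z t) (hg z t)) (hC1 _ _ t (hp t) (hq t)))
  have hD₂b : ∀ z t, |D₂ z t| ≤ C2 + C2 := fun z t => (abs_sub _ _).trans
    (add_le_add (hC2 _ _ t (hf z t) (hg z t)) (hC2 _ _ t (hp t) (hq t)))
  have hD₁sq : ∀ z t, D₁ z t ^ 2 ≤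
      ((α / (α - 1)) ^ 2 * Ca) * ((f z t - p t) ^ 2 + (g z t - q t) ^ 2) := fun z t => by
    simp only [D₁, gradFst]
    rw [← mul_sub, mul_pow, mul_assoc]
    gcongr
    exact hCa _ (hp t) _ (hq t) _ (hf z t) _ (hg z t)
  have hD₂sq : ∀ z t, D₂ z t ^ 2 ≤ Cb * ((f z t - p t) ^ 2 + (g z t - q t) ^ 2) := fun z t => by
    simp only [D₂, gradSnd]
    rw [← neg_add', ← sub_eq_add_neg, neg_sq]
    exact hCb _ (hp t) _ (hq t) _ (hf z t) _ (hg z t)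
  obtain ⟨i1, b1⟩ := integral_abs_mean_sub_le hB' hX hpm hqm hpm hp hq hp hp1 hfm hgm hf hg hZ hk
    hxm hx hZx hD₁ hD₁b hD₁sq
  obtain ⟨i2, b2⟩ := integral_abs_mean_sub_le hB' hX hpm hqm hqm hp hq hq hq1 hfm hgm hf hg hZ hl
    hym hy hZy hD₂ hD₂b hD₂sq
  -- the bias given `Z`; the other two parts of the remainder are centred averages given `Z`
  let R : S → ℝ := fun z => 1 / (1 - α) + ∫ t, gradFst α (f z) (g z) t ∂densityLaw X p
    + ∫ t, gradSnd α (f z) (g z) t ∂densityLaw X q - tsallis X α p q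
  have hRm : Measurable R := by
    have h1 : Measurable fun a : S × Euc ι => gradFst α (f a.1) (g a.1) a.2 :=
      measurable_gradFst α hfm hgm
    have h2 : Measurable fun a : S × Euc ι => gradSnd α (f a.1) (g a.1) a.2 :=
      measurable_gradSnd α hfm hgm
    exact ((measurable_const.add
      (h1.stronglyMeasurable.integral_prod_right' (ν := densityLaw X p)).measurable).add
      (h2.stronglyMeasurable.integral_prod_right' (ν := densityLaw X q)).measurable).sub
      measurable_const
  have iE : Integrable (fun ω => Cr * ((∫ t in X, (f (Z ω) t - p t) ^ 2)
      + ∫ t in X, (g (Z ω) t - q t) ^ 2)) P :=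
    ((integrable_integral_sq_sub hX P hfm hpm hf hp hZ).add
      (integrable_integral_sq_sub hX P hgm hqm hg hq hZ)).const_mul _
  have hRb : ∀ ω, |R (Z ω)| ≤ Cr * ((∫ t in X, (f (Z ω) t - p t) ^ 2)
      + ∫ t in X, (g (Z ω) t - q t) ^ 2) := fun ω =>
    hCr X hX p q _ _ hpm hqm (hfz _) (hgz _) hp hq (hf _) (hg _)
  have iR : Integrable (fun ω => R (Z ω)) P :=
    iE.mono' (hRm.comp hZ).aestronglyMeasurable (.of_forall hRb)
  have hdecomp : ∀ ω, linRemainder X α p q (f (Z ω)) (g (Z ω)) (x ω) (y ω) =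
      ((1 / (k : ℝ)) * ∑ i, D₁ (Z ω) (x ω i) - ∫ t, D₁ (Z ω) t ∂densityLaw X p)
      + ((1 / (l : ℝ)) * ∑ j, D₂ (Z ω) (y ω j) - ∫ t, D₂ (Z ω) t ∂densityLaw X q)
      + R (Z ω) := fun ω => by
    have g1 : ∀ u v : Euc ι → ℝ, Measurable u → Measurable v → (∀ t, u t ∈ Set.Icc B' B) →
        (∀ t, v t ∈ Set.Icc B' B) → Integrable (gradFst α u v) (densityLaw X p) :=
      fun u v hu hv hub hvb => .of_bound (measurable_gradFst α hu hv).aestronglyMeasurable C1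
        (.of_forall fun t => hC1 u v t (hub t) (hvb t))
    have g2 : ∀ u v : Euc ι → ℝ, Measurable u → Measurable v → (∀ t, u t ∈ Set.Icc B' B) →
        (∀ t, v t ∈ Set.Icc B' B) → Integrable (gradSnd α u v) (densityLaw X q) :=
      fun u v hu hv hub hvb => .of_bound (measurable_gradSnd α hu hv).aestronglyMeasurable C2
        (.of_forall fun t => hC2 u v t (hub t) (hvb t))
    simp only [D₁, D₂, R, linRemainder, prelim_eq]
    rw [integral_sub (g1 _ _ (hfz _) (hgz _) (hf _) (hg _)) (g1 _ _ hpm hqm hp hq),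
      integral_sub (g2 _ _ (hfz _) (hgz _) (hf _) (hg _)) (g2 _ _ hpm hqm hp hq),
      Finset.sum_sub_distrib, Finset.sum_sub_distrib]
    ring
  simp_rw [hdecomp]
  refine ⟨(i1.add i2).add iR, ?_⟩
  rintro e he
  have he0 : 0 ≤ e := he ▸ integral_nonneg fun ω =>
    add_nonneg (integral_nonneg fun t => sq_nonneg _) (integral_nonneg fun t => sq_nonneg _)
  rw [he] at b1 b2
  have b3 : ∫ ω, |R (Z ω)| ∂P ≤ Cr * e := by
    rw [← he, ← integral_const_mul]
    exact integral_mono iR.abs iE hRb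
  refine (integral_mono ((i1.add i2).add iR).abs ((i1.abs.add i2.abs).add iR.abs)
    fun ω => (abs_add_le _ _).trans (add_le_add_left (abs_add_le _ _) _)).trans ?_
  rw [integral_add' (i1.abs.add i2.abs) iR.abs, integral_add' i1.abs i2.abs, abs_of_pos hB]
  have hα2 := sq_nonneg (α / (α - 1))
  refine add_le_add (add_le_add (b1.trans ?_) (b2.trans ?_)) (b3.trans ?_)
  · gcongr
    nlinarith [mul_nonneg hB.le hCb0]
  · gcongr
    nlinarith [mul_nonneg hB.le (mul_nonneg hα2 hCa0)]
  · gcongr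
    nlinarith [mul_nonneg hB.le hCb0, mul_nonneg hB.le (mul_nonneg hα2 hCa0)]

end Linearisation

/-! ### A central limit theorem for two samples split into halves -/

section CentralLimit

variable {Ω : Type*} [MeasurableSpace Ω] {P : Measure Ω} [IsProbabilityMeasure P]

/-- The central limit theorem along sample sizes `N k → ∞`, with converging scaling factors, in
terms of characteristic functions. -/
lemma tendsto_charFun_pow {ξ : ℕ → Ω → ℝ} (hξ : iIndepFun ξ P)
    (hid : ∀ i, IdentDistrib (ξ i) (ξ 0) P P) (h2 : MemLp (ξ 0) 2 P) (h0 : P[ξ 0] = 0)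
    {N : ℕ → ℕ} (hN : Tendsto N atTop atTop) {a : ℕ → ℝ} {c : ℝ}
    (ha : Tendsto (fun k => a k * √(N k)) atTop (𝓝 c)) (t : ℝ) :
    Tendsto (fun k => charFun (P.map (ξ 0)) (a k * t) ^ N k) atTop
      (𝓝 (charFun (gaussianReal 0 (c ^ 2 * Var[ξ 0; P]).toNNReal) t)) := by
  have hclt := tendstoInDistribution_inv_sqrt_mul_sum_sub (Y := fun x : ℝ => x)
    (P' := gaussianReal 0 Var[ξ 0; P].toNNReal) .id h2 hξ hid
  simp only [h0, mul_zero, sub_zero] at hclt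
  have hsub : TendstoInDistribution
      (fun (k : ℕ) ω => (√(N k))⁻¹ * ∑ i ∈ Finset.range (N k), ξ i ω) atTop (fun x : ℝ => x)
      (fun _ => P) (gaussianReal 0 Var[ξ 0; P].toNNReal) :=
    ⟨fun k => hclt.forall_aemeasurable (N k), hclt.aemeasurable_limit, hclt.tendsto.comp hN⟩
  have hslut := hsub.continuous_comp_prodMk_of_tendstoInMeasure_const
    (g := fun x : ℝ × ℝ => x.2 * x.1) (by fun_prop) (Y := fun k _ => a k * √(N k)) (c := c)
    (tendstoInMeasure_of_tendsto_ae (fun k => aestronglyMeasurable_const) (.of_forall fun _ => ha))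
    (fun k => aemeasurable_const)
  have hchar := ProbabilityMeasure.tendsto_iff_tendsto_charFun.1 hslut.tendsto t
  have hlim : (gaussianReal 0 Var[ξ 0; P].toNNReal).map (fun x => c * x) =
      gaussianReal 0 (c ^ 2 * Var[ξ 0; P]).toNNReal := by
    rw [gaussianReal_map_const_mul, mul_zero, Real.toNNReal_mul (sq_nonneg c)]
    congr 2
    ext
    simp [Real.coe_toNNReal _ (sq_nonneg c)]
  simp only [ProbabilityMeasure.coe_mk, hlim] at hchar
  refine hchar.congr' ?_
  filter_upwards [hN.eventually_gt_atTop 0] with k hk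
  have hsq : √(N k : ℝ) ≠ 0 := by positivity
  have := charFun_inv_sqrt_mul_sum hξ hid (n := N k) (t := a k * √(N k) * t)
  rw [charFun_map_mul_comp (hsub.forall_aemeasurable k), this]
  congr 2
  field_simp

/-- The central limit theorem for two independent samples, with one weight for each half of each
sample.  The two halves of the first sample contribute `c ^ 2 * Var` each, hence the factors `2`. -/
lemma tendstoInDistribution_halves {ξ η : ℕ → Ω → ℝ} (hind : iIndepFun (Sum.elim ξ η) P)
    (hξid : ∀ i, IdentDistrib (ξ i) (ξ 0) P P) (hηid : ∀ i, IdentDistrib (η i) (η 0) P P)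
    (hξ2 : MemLp (ξ 0) 2 P) (hη2 : MemLp (η 0) 2 P) (hξ0 : P[ξ 0] = 0) (hη0 : P[η 0] = 0)
    {n₁ n₂ m₁ m₂ : ℕ → ℕ} (hn₁ : Tendsto n₁ atTop atTop) (hn₂ : Tendsto n₂ atTop atTop)
    (hm₁ : Tendsto m₁ atTop atTop) (hm₂ : Tendsto m₂ atTop atTop)
    {a₁ a₂ b₁ b₂ : ℕ → ℝ} {c d : ℝ}
    (ha₁ : Tendsto (fun k => a₁ k * √(n₁ k)) atTop (𝓝 c))
    (ha₂ : Tendsto (fun k => a₂ k * √(n₂ k)) atTop (𝓝 c))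
    (hb₁ : Tendsto (fun k => b₁ k * √(m₁ k)) atTop (𝓝 d))
    (hb₂ : Tendsto (fun k => b₂ k * √(m₂ k)) atTop (𝓝 d)) :
    TendstoInDistribution (fun (k : ℕ) ω =>
      (a₁ k * ∑ i ∈ Finset.range (n₁ k), ξ i ω + a₂ k * ∑ i ∈ Finset.range (n₂ k), ξ (n₁ k + i) ω)
      + (b₁ k * ∑ j ∈ Finset.range (m₁ k), η j ω
        + b₂ k * ∑ j ∈ Finset.range (m₂ k), η (m₁ k + j) ω))
      atTop (fun x : ℝ => x) (fun _ => P)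
      (gaussianReal 0 (2 * c ^ 2 * Var[ξ 0; P] + 2 * d ^ 2 * Var[η 0; P]).toNNReal) := by
  have hξ : iIndepFun ξ P := hind.precomp (g := Sum.inl) Sum.inl_injective
  have hη : iIndepFun η P := hind.precomp (g := Sum.inr) Sum.inr_injective
  have hξm : ∀ i, AEMeasurable (ξ i) P := fun i => (hξid i).aemeasurable_fst
  have hηm : ∀ i, AEMeasurable (η i) P := fun i => (hηid i).aemeasurable_fst
  refine ⟨fun k => ?_, aemeasurable_id,
    ProbabilityMeasure.tendsto_iff_tendsto_charFun.2 fun t => ?_⟩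
  · fun_prop
  have key : ∀ k, charFun (P.map fun ω =>
      (a₁ k * ∑ i ∈ Finset.range (n₁ k), ξ i ω + a₂ k * ∑ i ∈ Finset.range (n₂ k), ξ (n₁ k + i) ω)
      + (b₁ k * ∑ j ∈ Finset.range (m₁ k), η j ω
        + b₂ k * ∑ j ∈ Finset.range (m₂ k), η (m₁ k + j) ω)) t =
      (charFun (P.map (ξ 0)) (a₁ k * t) ^ n₁ k * charFun (P.map (ξ 0)) (a₂ k * t) ^ n₂ k) *
      (charFun (P.map (η 0)) (b₁ k * t) ^ m₁ k * charFun (P.map (η 0)) (b₂ k * t) ^ m₂ k) := by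
    intro k
    -- one weighted family indexed by both samples, so that joint independence applies at once
    let w : ℕ ⊕ ℕ → ℝ := Sum.elim (fun i => if i < n₁ k then a₁ k else a₂ k)
      (fun j => if j < m₁ k then b₁ k else b₂ k)
    let Y : ℕ ⊕ ℕ → Ω → ℝ := fun x ω => w x * Sum.elim ξ η x ω
    have hYm : ∀ x, AEMeasurable (Y x) P := by
      rintro (i | j)
      · exact (hξm i).const_mul _
      · exact (hηm j).const_mul _
    have hY : iIndepFun Y P := hind.comp (fun x y => w x * y) fun x => measurable_const_mul _
    let s : Finset (ℕ ⊕ ℕ) := (Finset.range (n₁ k + n₂ k)).disjSum (Finset.range (m₁ k + m₂ k))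
    have hsum : (fun ω => (a₁ k * ∑ i ∈ Finset.range (n₁ k), ξ i ω
        + a₂ k * ∑ i ∈ Finset.range (n₂ k), ξ (n₁ k + i) ω)
        + (b₁ k * ∑ j ∈ Finset.range (m₁ k), η j ω
        + b₂ k * ∑ j ∈ Finset.range (m₂ k), η (m₁ k + j) ω)) = fun ω => ∑ x ∈ s, Y x ω := by
      funext ω
      simp only [s, Finset.sum_disjSum, Finset.sum_range_add, Y, w, Sum.elim_inl, Sum.elim_inr,
        Finset.mul_sum]
      congr 2 <;> refine Finset.sum_congr rfl fun i hi => ?_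
      all_goals first
        | rw [if_pos (Finset.mem_range.1 hi)]
        | rw [if_neg (by omega)]
    rw [hsum, (hY.restrict _).charFun_map_fun_finsetSum_eq_prod (fun x _ => hYm x)]
    have h1 : ∀ i, charFun (P.map (Y (.inl i))) t =
        charFun (P.map (ξ 0)) ((if i < n₁ k then a₁ k else a₂ k) * t) := fun i => by
      rw [← (hξid i).map_eq]
      exact charFun_map_mul_comp (hξm i) _ _
    have h2 : ∀ j, charFun (P.map (Y (.inr j))) t =
        charFun (P.map (η 0)) ((if j < m₁ k then b₁ k else b₂ k) * t) := fun j => by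
      rw [← (hηid j).map_eq]
      exact charFun_map_mul_comp (hηm j) _ _
    simp only [Finset.prod_apply, s, Finset.prod_disjSum, h1, h2, Finset.prod_range_add]
    congr 2
    all_goals rw [Finset.prod_congr rfl fun i hi => by
      first
        | rw [if_pos (Finset.mem_range.1 hi)]
        | rw [if_neg (by omega)]]
    all_goals simp
  have hlim : charFun (gaussianReal 0
      (2 * c ^ 2 * Var[ξ 0; P] + 2 * d ^ 2 * Var[η 0; P]).toNNReal) t =
      (charFun (gaussianReal 0 (c ^ 2 * Var[ξ 0; P]).toNNReal) t *
        charFun (gaussianReal 0 (c ^ 2 * Var[ξ 0; P]).toNNReal) t) *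
      (charFun (gaussianReal 0 (d ^ 2 * Var[η 0; P]).toNNReal) t *
        charFun (gaussianReal 0 (d ^ 2 * Var[η 0; P]).toNNReal) t) := by
    have hv1 := variance_nonneg (ξ 0) P
    have hv2 := variance_nonneg (η 0) P
    simp only [charFun_gaussianReal, ← Complex.exp_add]
    rw [Real.coe_toNNReal _ (by positivity), Real.coe_toNNReal _ (by positivity),
      Real.coe_toNNReal _ (by positivity)]
    congr 1
    push_cast
    ring
  simp only [ProbabilityMeasure.coe_mk, key, Measure.map_id']
  rw [hlim]
  exact ((tendsto_charFun_pow hξ hξid hξ2 hξ0 hn₁ ha₁ t).mul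
    (tendsto_charFun_pow hξ hξid hξ2 hξ0 hn₂ ha₂ t)).mul
    ((tendsto_charFun_pow hη hηid hη2 hη0 hm₁ hb₁ t).mul
    (tendsto_charFun_pow hη hηid hη2 hη0 hm₂ hb₂ t))

end CentralLimit

/-! ### Asymptotic normality for globally bounded measurable densities and estimators -/

section Core

variable {ι : Type} [Fintype ι]

lemma indepFun_of_disjoint_indices {Ω κ E : Type*} [MeasurableSpace Ω] [MeasurableSpace E]
    {P : Measure Ω} {U : κ → Ω → E} (hU : iIndepFun U P) (hm : ∀ i, Measurable (U i))
    {A B : Type*} [Fintype A] [Fintype B] (e : A → κ) (e' : B → κ) (h : ∀ a b, e a ≠ e' b) :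
    IndepFun (fun ω a => U (e a) ω) (fun ω b => U (e' b) ω) P := by
  classical
  have hd : Disjoint (Finset.univ.image e) (Finset.univ.image e') := by
    rw [Finset.disjoint_left]
    intro x hx hx'
    obtain ⟨a, -, rfl⟩ := Finset.mem_image.1 hx
    obtain ⟨b, -, hb⟩ := Finset.mem_image.1 hx'
    exact h a b hb.symm
  exact (hU.indepFun_finset _ _ hd hm).comp
    (φ := fun z a => z ⟨e a, Finset.mem_image_of_mem e (Finset.mem_univ a)⟩)
    (ψ := fun z b => z ⟨e' b, Finset.mem_image_of_mem e' (Finset.mem_univ b)⟩)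
    (measurable_pi_lambda _ fun a => measurable_pi_apply _)
    (measurable_pi_lambda _ fun a => measurable_pi_apply _)

lemma hasLaw_pi_of_injective {Ω κ E : Type*} [MeasurableSpace Ω] [MeasurableSpace E]
    {P : Measure Ω} {μ : Measure E} {U : κ → Ω → E} (hU : iIndepFun U P)
    (hl : ∀ i, HasLaw (U i) μ P) {A : Type*} [Fintype A] {e : A → κ} (he : e.Injective) :
    HasLaw (fun ω a => U (e a) ω) (Measure.pi fun _ : A => μ) P where
  aemeasurable := aemeasurable_pi_lambda _ fun a => (hl (e a)).aemeasurable
  map_eq := by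
    rw [(hU.precomp he).map_fun_eq_pi_map fun a => (hl (e a)).aemeasurable]
    simp [fun a => (hl (e a)).map_eq]

/-- The mean integrated squared error at `p` of a density estimator from `k` observations. -/
noncomputable def mise (X : Set (Euc ι)) (p : Euc ι → ℝ) (phat : DensityEstimator ι) (k : ℕ) : ℝ :=
  ∫ v, (∫ x in X, (phat k v x - p x) ^ 2) ∂(Measure.pi fun _ : Fin k => densityLaw X p)

lemma mise_nonneg (X : Set (Euc ι)) (p : Euc ι → ℝ) (phat : DensityEstimator ι) (k : ℕ) :
    0 ≤ mise X p phat k :=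
  integral_nonneg fun _ => integral_nonneg fun _ => sq_nonneg _

/-- The linearisation error of one half of the data-split estimator, in which the densities are
estimated from the observations with indices `e₁`, `d₁`, and averages are taken over those with
indices `e₂`, `d₂`. -/
lemma exists_integral_abs_linRemainder_le_mise {B' B : ℝ} (hB' : 0 < B') {α : ℝ} (hα1 : α ≠ 1)
    {X : Set (Euc ι)} (hX : volume X ≠ ∞) {p q : Euc ι → ℝ} (hpm : Measurable p)
    (hqm : Measurable q) (hp : ∀ x, p x ∈ Set.Icc B' B) (hq : ∀ x, q x ∈ Set.Icc B' B)
    (hp1 : ∫ x in X, p x = 1) (hq1 : ∫ x in X, q x = 1)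
    {Ω : Type*} [MeasurableSpace Ω] {P : Measure Ω} [IsProbabilityMeasure P]
    {V W : ℕ → Ω → Euc ι} (hVm : ∀ i, Measurable (V i)) (hWm : ∀ j, Measurable (W j))
    (hV : ∀ i, HasLaw (V i) (densityLaw X p) P) (hW : ∀ j, HasLaw (W j) (densityLaw X q) P)
    (hind : iIndepFun (Sum.elim V W) P) {phat qhat : DensityEstimator ι}
    (hphm : ∀ k, Measurable fun a : (Fin k → Euc ι) × Euc ι => phat k a.1 a.2)
    (hqhm : ∀ k, Measurable fun a : (Fin k → Euc ι) × Euc ι => qhat k a.1 a.2)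
    (hph : ∀ k v x, phat k v x ∈ Set.Icc B' B) (hqh : ∀ k v x, qhat k v x ∈ Set.Icc B' B) :
    ∃ C, 0 ≤ C ∧ ∀ (k₁ k₂ l₁ l₂ : ℕ) (e₁ : Fin k₁ → ℕ) (e₂ : Fin k₂ → ℕ) (d₁ : Fin l₁ → ℕ)
      (d₂ : Fin l₂ → ℕ), 0 < k₂ → 0 < l₂ → e₁.Injective → e₂.Injective → d₁.Injective →
      d₂.Injective → (∀ i j, e₁ i ≠ e₂ j) → (∀ i j, d₁ i ≠ d₂ j) →
      Integrable (fun ω => linRemainder X α p q (phat k₁ fun i => V (e₁ i) ω)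
        (qhat l₁ fun j => W (d₁ j) ω) (fun i => V (e₂ i) ω) (fun j => W (d₂ j) ω)) P ∧
      ∫ ω, |linRemainder X α p q (phat k₁ fun i => V (e₁ i) ω)
        (qhat l₁ fun j => W (d₁ j) ω) (fun i => V (e₂ i) ω) (fun j => W (d₂ j) ω)| ∂P ≤
        √(1 / (k₂ : ℝ) * (C * (mise X p phat k₁ + mise X q qhat l₁)))
          + √(1 / (l₂ : ℝ) * (C * (mise X p phat k₁ + mise X q qhat l₁)))
          + C * (mise X p phat k₁ + mise X q qhat l₁) := by
  obtain ⟨C, hC0, hC⟩ := exists_integral_abs_linRemainder_le (ι := ι) (B := B) hB' hα1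
  refine ⟨C, hC0, fun k₁ k₂ l₁ l₂ e₁ e₂ d₁ d₂ hk hl he₁ he₂ hd₁ hd₂ hne hnd => ?_⟩
  have hUm : ∀ x, Measurable (Sum.elim V W x) := by
    rintro (i | j)
    · exact hVm i
    · exact hWm j
  have hVi : iIndepFun V P := hind.precomp (g := Sum.inl) Sum.inl_injective
  have hWi : iIndepFun W P := hind.precomp (g := Sum.inr) Sum.inr_injective
  let S := (Fin k₁ → Euc ι) × (Fin l₁ → Euc ι)
  let Z : Ω → S := fun ω => (fun i => V (e₁ i) ω, fun j => W (d₁ j) ω)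
  have hZm1 : Measurable fun ω (i : Fin k₁) => V (e₁ i) ω :=
    measurable_pi_lambda _ fun i => hVm _
  have hZm2 : Measurable fun ω (j : Fin l₁) => W (d₁ j) ω :=
    measurable_pi_lambda _ fun i => hWm _
  have hZ : Measurable Z := hZm1.prodMk hZm2
  have hsplit : Measurable fun z : Fin k₁ ⊕ Fin l₁ → Euc ι =>
      ((fun i => z (.inl i), fun j => z (.inr j)) : S) :=
    (measurable_pi_lambda _ fun i => measurable_pi_apply _).prodMk
      (measurable_pi_lambda _ fun i => measurable_pi_apply _)
  have hZx : IndepFun Z (fun ω (i : Fin k₂) => V (e₂ i) ω) P :=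
    (indepFun_of_disjoint_indices hind hUm
      (Sum.elim (fun i => .inl (e₁ i)) (fun j => .inr (d₁ j)) : Fin k₁ ⊕ Fin l₁ → ℕ ⊕ ℕ)
      (fun i : Fin k₂ => .inl (e₂ i)) (by
        rintro (i | j) i'
        · simpa using hne i i'
        · simp)).comp hsplit measurable_id
  have hZy : IndepFun Z (fun ω (j : Fin l₂) => W (d₂ j) ω) P :=
    (indepFun_of_disjoint_indices hind hUm
      (Sum.elim (fun i => .inl (e₁ i)) (fun j => .inr (d₁ j)) : Fin k₁ ⊕ Fin l₁ → ℕ ⊕ ℕ)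
      (fun j : Fin l₂ => .inr (d₂ j)) (by
        rintro (i | j) j'
        · simp
        · simpa using hnd j j')).comp hsplit measurable_id
  have hfm : Measurable fun a : S × Euc ι => phat k₁ a.1.1 a.2 :=
    (hphm k₁).comp ((measurable_fst.comp measurable_fst).prodMk measurable_snd)
  have hgm : Measurable fun a : S × Euc ι => qhat l₁ a.1.2 a.2 :=
    (hqhm l₁).comp ((measurable_snd.comp measurable_fst).prodMk measurable_snd)
  obtain ⟨h1, h2⟩ := hC X hX p q hpm hqm hp hq hp1 hq1 P (fun z : S => phat k₁ z.1)
    (fun z : S => qhat l₁ z.2) hfm hgm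
    (fun z => hph k₁ z.1) (fun z => hqh l₁ z.2) Z k₂ l₂ (fun ω i => V (e₂ i) ω)
    (fun ω j => W (d₂ j) ω) hZ hk hl (measurable_pi_lambda _ fun i => hVm _)
    (measurable_pi_lambda _ fun i => hWm _) (hasLaw_pi_of_injective hVi hV he₂)
    (hasLaw_pi_of_injective hWi hW hd₂) hZx hZy
  refine ⟨h1, h2 _ ?_⟩
  rw [integral_add (integrable_integral_sq_sub (u := fun z : S => phat k₁ z.1) hX P hfm hpm
      (fun z => hph k₁ z.1) hp hZ)
    (integrable_integral_sq_sub (u := fun z : S => qhat l₁ z.2) hX P hgm hqm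
      (fun z => hqh l₁ z.2) hq hZ)]
  have hfin : IsFiniteMeasure (volume.restrict X) := isFiniteMeasure_restrict.2 hX
  congr 1
  · refine (hasLaw_pi_of_injective hVi hV he₁).integral_comp
      (f := fun v => ∫ t in X, (phat k₁ v t - p t) ^ 2) (Measurable.aestronglyMeasurable ?_)
    have : Measurable fun a : (Fin k₁ → Euc ι) × Euc ι => (phat k₁ a.1 a.2 - p a.2) ^ 2 :=
      ((hphm k₁).sub (hpm.comp measurable_snd)).pow_const 2
    exact (this.stronglyMeasurable.integral_prod_right' (ν := volume.restrict X)).measurable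
  · refine (hasLaw_pi_of_injective hWi hW hd₁).integral_comp
      (f := fun v => ∫ t in X, (qhat l₁ v t - q t) ^ 2) (Measurable.aestronglyMeasurable ?_)
    have : Measurable fun a : (Fin l₁ → Euc ι) × Euc ι => (qhat l₁ a.1 a.2 - q a.2) ^ 2 :=
      ((hqhm l₁).sub (hqm.comp measurable_snd)).pow_const 2
    exact (this.stronglyMeasurable.integral_prod_right' (ν := volume.restrict X)).measurable

lemma tendstoInMeasure_zero_of_integral_abs_le {Ω : Type*} [MeasurableSpace Ω] {P : Measure Ω}
    {f : ℕ → Ω → ℝ} {b : ℕ → ℝ} (hf : ∀ k, AEStronglyMeasurable (f k) P)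
    (hb : Tendsto b atTop (𝓝 0)) (h : ∀ᶠ k in atTop, Integrable (f k) P ∧ ∫ ω, |f k ω| ∂P ≤ b k) :
    TendstoInMeasure P f atTop 0 := by
  refine tendstoInMeasure_of_tendsto_eLpNorm one_ne_zero hf aestronglyMeasurable_zero ?_
  have hb' : Tendsto (fun k => ENNReal.ofReal (b k)) atTop (𝓝 0) := by
    simpa using ENNReal.tendsto_ofReal hb
  refine tendsto_of_tendsto_of_tendsto_of_le_of_le' tendsto_const_nhds hb'
    (.of_forall fun k => zero_le) ?_
  filter_upwards [h] with k hk
  rw [sub_zero, eLpNorm_one_eq_lintegral_enorm, ← ofReal_integral_norm_eq_lintegral_enorm hk.1]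
  exact ENNReal.ofReal_le_ofReal hk.2

lemma tendsto_half_div {n : ℕ → ℕ} (hn : Tendsto n atTop atTop) :
    Tendsto (fun k => ((n k / 2 : ℕ) : ℝ) / n k) atTop (𝓝 (1 / 2)) ∧
      Tendsto (fun k => ((n k - n k / 2 : ℕ) : ℝ) / n k) atTop (𝓝 (1 / 2)) := by
  have hn' : Tendsto (fun k => (n k : ℝ)) atTop atTop := tendsto_natCast_atTop_atTop.comp hn
  have h1 : Tendsto (fun k => ((n k / 2 : ℕ) : ℝ) / n k) atTop (𝓝 (1 / 2)) := by
    have hl : Tendsto (fun k => 1 / 2 - (n k : ℝ)⁻¹) atTop (𝓝 (1 / 2)) := by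
      simpa using (tendsto_const_nhds (x := (1 / 2 : ℝ))).sub (tendsto_inv_atTop_zero.comp hn')
    refine tendsto_of_tendsto_of_tendsto_of_le_of_le' hl tendsto_const_nhds ?_ ?_ <;>
    filter_upwards [hn.eventually_gt_atTop 0] with k hk <;>
    have hk' : (0 : ℝ) < n k := by exact_mod_cast hk
    · rw [le_div_iff₀ hk', sub_mul, inv_mul_cancel₀ hk'.ne']
      have : (n k : ℝ) ≤ 2 * ((n k / 2 : ℕ) : ℝ) + 2 := by exact_mod_cast (by omega)
      linarith
    · rw [div_le_iff₀ hk']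
      have : 2 * ((n k / 2 : ℕ) : ℝ) ≤ n k := by exact_mod_cast (by omega)
      linarith
  refine ⟨h1, ?_⟩
  have h2 := (tendsto_const_nhds (x := (1 : ℝ))).sub h1
  norm_num at h2
  refine h2.congr' ?_
  filter_upwards [hn.eventually_gt_atTop 0] with k hk
  have hk' : (n k : ℝ) ≠ 0 := by positivity
  rw [Nat.cast_sub (by omega)]
  field_simp

/-- The weight `√N / (2 j)` is carried by each observation of a subsample of size `j`: the factor
`√N` is the normalisation, and the two halves of the estimator are averaged. -/
lemma tendsto_sqrt_div_mul_sqrt {N j : ℕ → ℕ} (hj : Tendsto j atTop atTop) {c : ℝ} (hc : 0 < c)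
    (hjN : Tendsto (fun k => (j k : ℝ) / N k) atTop (𝓝 c)) :
    Tendsto (fun k => √(N k : ℝ) / (2 * j k) * √(j k : ℝ)) atTop (𝓝 (1 / 2 * (√c)⁻¹)) := by
  refine (((hjN.sqrt).inv₀ (by positivity)).const_mul (1 / 2)).congr' ?_
  filter_upwards [hj.eventually_gt_atTop 0] with k hk
  have hk' : (0 : ℝ) < j k := by exact_mod_cast hk
  rw [Real.sqrt_div' _ (Nat.cast_nonneg _), inv_div]
  have h : (j k : ℝ) = √(j k : ℝ) * √(j k : ℝ) := (Real.mul_self_sqrt hk'.le).symm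
  have : √(j k : ℝ) ≠ 0 := by positivity
  nth_rewrite 2 [h]
  field_simp

lemma tendsto_sqrt_mul_of_div {N j : ℕ → ℕ} (hj : Tendsto j atTop atTop) {c : ℝ} (hc : 0 < c)
    (hjN : Tendsto (fun k => (j k : ℝ) / N k) atTop (𝓝 c)) {M : ℕ → ℝ}
    (hM : Tendsto (fun k : ℕ => √(k : ℝ) * M k) atTop (𝓝 0)) :
    Tendsto (fun k => √(N k : ℝ) * M (j k)) atTop (𝓝 0) := by
  have h := ((hjN.sqrt).inv₀ (by positivity)).mul (hM.comp hj)
  rw [mul_zero] at h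
  refine h.congr' ?_
  filter_upwards [hj.eventually_gt_atTop 0] with k hk
  have hk' : (0 : ℝ) < j k := by exact_mod_cast hk
  have : √(j k : ℝ) ≠ 0 := by positivity
  rw [Real.sqrt_div' _ (Nat.cast_nonneg _), inv_div, Function.comp_apply]
  field_simp

/-- The bound of `exists_integral_abs_linRemainder_le_mise` is `o(N ^ (-1/2))` when the mean
integrated squared errors `E` are. -/
lemma tendsto_sqrt_mul_remainder_bound {N j l : ℕ → ℕ} (hN : Tendsto N atTop atTop) {c d : ℝ}
    (hc : 0 < c) (hd : 0 < d) (hjN : Tendsto (fun k => (j k : ℝ) / N k) atTop (𝓝 c))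
    (hlN : Tendsto (fun k => (l k : ℝ) / N k) atTop (𝓝 d)) {E : ℕ → ℝ} (C : ℝ)
    (hE : Tendsto (fun k => √(N k : ℝ) * E k) atTop (𝓝 0)) :
    Tendsto (fun k => √(N k : ℝ) * (√(1 / (j k : ℝ) * (C * E k)) + √(1 / (l k : ℝ) * (C * E k))
      + C * E k)) atTop (𝓝 0) := by
  have hN' : Tendsto (fun k => √(N k : ℝ)) atTop atTop :=
    Real.tendsto_sqrt_atTop.comp (tendsto_natCast_atTop_atTop.comp hN)
  have hE0 : Tendsto E atTop (𝓝 0) := by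
    have h := (tendsto_inv_atTop_zero.comp hN').mul hE
    rw [mul_zero] at h
    refine h.congr' ?_
    filter_upwards [hN'.eventually_gt_atTop 0] with k hk
    simp only [Function.comp_apply]
    field_simp
  have aux : ∀ {r : ℕ → ℕ} {b : ℝ}, 0 < b → Tendsto (fun k => (r k : ℝ) / N k) atTop (𝓝 b) →
      Tendsto (fun k => √(N k : ℝ) * √(1 / (r k : ℝ) * (C * E k))) atTop (𝓝 0) := by
    intro r b hb hr
    have h := ((hr.inv₀ hb.ne').mul (hE0.const_mul C)).sqrt
    simp only [mul_zero, Real.sqrt_zero] at h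
    refine h.congr fun k => ?_
    rw [← Real.sqrt_mul (Nat.cast_nonneg _), inv_div]
    congr 1
    ring
  have h := ((aux hc hjN).add (aux hd hlN)).add (hE.const_mul C)
  simp only [mul_zero, add_zero] at h
  refine h.congr fun k => ?_
  ring

lemma tendsto_halves_div {n N : ℕ → ℕ} (hn : Tendsto n atTop atTop) {ζ : ℝ}
    (hnN : Tendsto (fun k => (n k : ℝ) / N k) atTop (𝓝 ζ)) :
    Tendsto (fun k => ((n k / 2 : ℕ) : ℝ) / N k) atTop (𝓝 (ζ / 2)) ∧
      Tendsto (fun k => ((n k - n k / 2 : ℕ) : ℝ) / N k) atTop (𝓝 (ζ / 2)) := by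
  have aux : ∀ {r : ℕ → ℕ}, Tendsto (fun k => (r k : ℝ) / n k) atTop (𝓝 (1 / 2)) →
      Tendsto (fun k => (r k : ℝ) / N k) atTop (𝓝 (ζ / 2)) := by
    intro r hr
    have h := hr.mul hnN
    rw [one_div_mul_eq_div] at h
    refine h.congr' ?_
    filter_upwards [hn.eventually_gt_atTop 0] with k hk
    have hk' : (n k : ℝ) ≠ 0 := by positivity
    field_simp
  exact ⟨aux (tendsto_half_div hn).1, aux (tendsto_half_div hn).2⟩

lemma measurable_prelim (α : ℝ) {Ω : Type*} [MeasurableSpace Ω] {phat qhat : DensityEstimator ι}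
    (hphm : ∀ k, Measurable fun a : (Fin k → Euc ι) × Euc ι => phat k a.1 a.2)
    (hqhm : ∀ k, Measurable fun a : (Fin k → Euc ι) × Euc ι => qhat k a.1 a.2)
    {k₁ k₂ l₁ l₂ : ℕ} {v₁ : Ω → Fin k₁ → Euc ι} {v₂ : Ω → Fin k₂ → Euc ι}
    {w₁ : Ω → Fin l₁ → Euc ι} {w₂ : Ω → Fin l₂ → Euc ι} (hv₁ : Measurable v₁) (hv₂ : Measurable v₂)
    (hw₁ : Measurable w₁) (hw₂ : Measurable w₂) :
    Measurable fun ω => prelim α (phat k₁ (v₁ ω)) (qhat l₁ (w₁ ω)) (v₂ ω) (w₂ ω) := by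
  have h : ∀ (β : ℝ) {x : Ω → Euc ι}, Measurable x →
      Measurable fun ω => (phat k₁ (v₁ ω) (x ω) / qhat l₁ (w₁ ω) (x ω)) ^ β := fun β x hx =>
    (((hphm k₁).comp (hv₁.prodMk hx)).div ((hqhm l₁).comp (hw₁.prodMk hx))).pow_const β
  unfold prelim
  refine (measurable_const.add (Measurable.const_mul (Measurable.const_mul
    (Finset.measurable_sum _ fun i _ => ?_) _) _)).sub
    (Measurable.const_mul (Finset.measurable_sum _ fun i _ => ?_) _)
  · exact h _ ((measurable_pi_apply i).comp hv₂)
  · exact h _ ((measurable_pi_apply i).comp hw₂)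

lemma psiXZ_eq {X : Set (Euc ι)} {α : ℝ} {p q : Euc ι → ℝ} {v : Euc ι} (hp : 0 < p v)
    (hq : 0 < q v) :
    psiXZ X α p q v = gradFst α p q v - α / (α - 1) * powerIntegral X α p q := by
  rw [psiXZ, gradFst, Real.div_rpow hp.le hq.le, ← neg_sub α 1, Real.rpow_neg hq.le]
  ring

lemma psiYZ_eq {X : Set (Euc ι)} {α : ℝ} {p q : Euc ι → ℝ} {w : Euc ι} (hp : 0 < p w)
    (hq : 0 < q w) : psiYZ X α p q w = gradSnd α p q w + powerIntegral X α p q := by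
  rw [psiYZ, gradSnd, Real.div_rpow hp.le hq.le, Real.rpow_neg hq.le]
  ring

/-- Asymptotic normality when densities and estimators are measurable with values in `[B', B]`
everywhere, and the observations are measurable.  The estimator is the linear part treated by
`tendstoInDistribution_halves` plus two remainders that are small in `L¹`. -/
theorem dsAsympNormal_of_measurable {B' B : ℝ} (hB' : 0 < B') {α : ℝ} (hα1 : α ≠ 1)
    {X : Set (Euc ι)} (hX : volume X ≠ ∞) {p q : Euc ι → ℝ} (hpm : Measurable p)
    (hqm : Measurable q) (hp : ∀ x, p x ∈ Set.Icc B' B) (hq : ∀ x, q x ∈ Set.Icc B' B)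
    (hp1 : ∫ x in X, p x = 1) (hq1 : ∫ x in X, q x = 1)
    {Ω : Type*} [MeasurableSpace Ω] {P : Measure Ω} [IsProbabilityMeasure P]
    {V W : ℕ → Ω → Euc ι} (hVm : ∀ i, Measurable (V i)) (hWm : ∀ j, Measurable (W j))
    (hV : ∀ i, HasLaw (V i) (densityLaw X p) P) (hW : ∀ j, HasLaw (W j) (densityLaw X q) P)
    (hind : iIndepFun (Sum.elim V W) P) {phat qhat : DensityEstimator ι}
    (hphm : ∀ k, Measurable fun a : (Fin k → Euc ι) × Euc ι => phat k a.1 a.2)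
    (hqhm : ∀ k, Measurable fun a : (Fin k → Euc ι) × Euc ι => qhat k a.1 a.2)
    (hph : ∀ k v x, phat k v x ∈ Set.Icc B' B) (hqh : ∀ k v x, qhat k v x ∈ Set.Icc B' B)
    (hpr : Tendsto (fun k : ℕ => √(k : ℝ) * mise X p phat k) atTop (𝓝 0))
    (hqr : Tendsto (fun k : ℕ => √(k : ℝ) * mise X q qhat k) atTop (𝓝 0))
    {ζ : ℝ} (hζ0 : 0 < ζ) (hζ1 : ζ < 1) {n m : ℕ → ℕ}
    (hn : Tendsto n atTop atTop) (hm : Tendsto m atTop atTop)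
    (hnm : Tendsto (fun k => (n k : ℝ) / ((n k : ℝ) + (m k : ℝ))) atTop (𝓝 ζ)) :
    DSAsympNormal P V W n m X α ζ p q phat qhat := by
  have hp0 : ∀ x, 0 < p x := fun x => hB'.trans_le (hp x).1
  have hq0 : ∀ x, 0 < q x := fun x => hB'.trans_le (hq x).1
  have hμ : IsProbabilityMeasure (densityLaw X p) :=
    isProbabilityMeasure_densityLaw (.of_forall fun x => (hp0 x).le) hp1
  have hν : IsProbabilityMeasure (densityLaw X q) :=
    isProbabilityMeasure_densityLaw (.of_forall fun x => (hq0 x).le) hq1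
  obtain ⟨C1, -, hC1⟩ := exists_abs_gradFst_le (ι := ι) (B := B) hB' α
  obtain ⟨C2, -, hC2⟩ := exists_abs_gradSnd_le (ι := ι) (B := B) hB' α
  have hA : Measurable (gradFst α p q) := measurable_gradFst α hpm hqm
  have hD : Measurable (gradSnd α p q) := measurable_gradSnd α hpm hqm
  have hA2 : MemLp (gradFst α p q) 2 (densityLaw X p) :=
    .of_bound hA.aestronglyMeasurable C1 (.of_forall fun x => hC1 p q x (hp x) (hq x))
  have hD2 : MemLp (gradSnd α p q) 2 (densityLaw X q) :=
    .of_bound hD.aestronglyMeasurable C2 (.of_forall fun x => hC2 p q x (hp x) (hq x))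
  -- the sample sizes and their halves
  let N : ℕ → ℕ := fun k => n k + m k
  have hN : Tendsto N atTop atTop := tendsto_atTop_mono (fun k => Nat.le_add_right _ _) hn
  have hnN : Tendsto (fun k => (n k : ℝ) / N k) atTop (𝓝 ζ) := by simpa [N] using hnm
  have hmN : Tendsto (fun k => (m k : ℝ) / N k) atTop (𝓝 (1 - ζ)) := by
    refine ((tendsto_const_nhds (x := (1 : ℝ))).sub hnN).congr' ?_
    filter_upwards [hN.eventually_gt_atTop 0] with k hk
    have hk' : (N k : ℝ) ≠ 0 := by positivity
    rw [eq_div_iff hk', sub_mul, div_mul_cancel₀ _ hk']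
    simp [N]
  obtain ⟨hn₁N, hn₂N⟩ := tendsto_halves_div hn hnN
  obtain ⟨hm₁N, hm₂N⟩ := tendsto_halves_div hm hmN
  have hhalf : Tendsto (fun j : ℕ => j / 2) atTop atTop :=
    tendsto_atTop.2 fun b => (eventually_ge_atTop (2 * b)).mono fun j hj => by omega
  have hhalf' : Tendsto (fun j : ℕ => j - j / 2) atTop atTop :=
    tendsto_atTop.2 fun b => (eventually_ge_atTop (2 * b)).mono fun j hj => by omega
  have hn₁ := hhalf.comp hn
  have hn₂ := hhalf'.comp hn
  have hm₁ := hhalf.comp hm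
  have hm₂ := hhalf'.comp hm
  have hζ0' : 0 < ζ / 2 := by positivity
  have hζ1' : 0 < (1 - ζ) / 2 := by linarith
  -- the linear part
  let ξ : ℕ → Ω → ℝ := fun i ω => gradFst α p q (V i ω) - ∫ t, gradFst α p q t ∂densityLaw X p
  let η : ℕ → Ω → ℝ := fun j ω => gradSnd α p q (W j ω) - ∫ t, gradSnd α p q t ∂densityLaw X q
  have hξη : iIndepFun (Sum.elim ξ η) P := by
    have h := hind.comp (Sum.elim
      (fun _ v => gradFst α p q v - ∫ t, gradFst α p q t ∂densityLaw X p)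
      (fun _ w => gradSnd α p q w - ∫ t, gradSnd α p q t ∂densityLaw X q)) (by
        rintro (i | j)
        · exact hA.sub_const _
        · exact hD.sub_const _)
    convert h using 1
    funext x
    rcases x with i | j <;> rfl
  have hVid : ∀ i, IdentDistrib (V i) (V 0) P P := fun i =>
    ⟨(hV i).aemeasurable, (hV 0).aemeasurable, by rw [(hV i).map_eq, (hV 0).map_eq]⟩
  have hWid : ∀ i, IdentDistrib (W i) (W 0) P P := fun i =>
    ⟨(hW i).aemeasurable, (hW 0).aemeasurable, by rw [(hW i).map_eq, (hW 0).map_eq]⟩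
  have hξid : ∀ i, IdentDistrib (ξ i) (ξ 0) P P := fun i => (hVid i).comp (hA.sub_const _)
  have hηid : ∀ i, IdentDistrib (η i) (η 0) P P := fun i => (hWid i).comp (hD.sub_const _)
  have hAV : MemLp (fun ω => gradFst α p q (V 0 ω)) 2 P :=
    hA2.comp_measurePreserving ((hV 0).measurePreserving (hVm 0))
  have hDW : MemLp (fun ω => gradSnd α p q (W 0 ω)) 2 P :=
    hD2.comp_measurePreserving ((hW 0).measurePreserving (hWm 0))
  have hξ2 : MemLp (ξ 0) 2 P := hAV.sub (memLp_const _)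
  have hη2 : MemLp (η 0) 2 P := hDW.sub (memLp_const _)
  have hξ0 : P[ξ 0] = 0 := by
    have := (hV 0).integral_comp (f := gradFst α p q) hA.aestronglyMeasurable
    simp only [Function.comp_def] at this
    simp only [ξ]
    rw [integral_sub (hAV.integrable (by norm_num)) (integrable_const _), this]
    simp
  have hη0 : P[η 0] = 0 := by
    have := (hW 0).integral_comp (f := gradSnd α p q) hD.aestronglyMeasurable
    simp only [Function.comp_def] at this
    simp only [η]
    rw [integral_sub (hDW.integrable (by norm_num)) (integrable_const _), this]
    simp
  have hvξ : Var[ξ 0; P] = Var[psiXZ X α p q; densityLaw X p] := by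
    have e1 : psiXZ X α p q = fun v => gradFst α p q v - α / (α - 1) * powerIntegral X α p q :=
      funext fun v => psiXZ_eq (hp0 v) (hq0 v)
    have e2 := variance_map (X := gradFst α p q) (Y := V 0) (μ := P)
      hA.aemeasurable (hV 0).aemeasurable
    rw [(hV 0).map_eq] at e2
    rw [e1, variance_sub_const hA.aestronglyMeasurable, e2,
      variance_sub_const hAV.aestronglyMeasurable]
    rfl
  have hvη : Var[η 0; P] = Var[psiYZ X α p q; densityLaw X q] := by
    have e1 : psiYZ X α p q = fun v => gradSnd α p q v + powerIntegral X α p q :=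
      funext fun v => psiYZ_eq (hp0 v) (hq0 v)
    have e2 := variance_map (X := gradSnd α p q) (Y := W 0) (μ := P)
      hD.aemeasurable (hW 0).aemeasurable
    rw [(hW 0).map_eq] at e2
    rw [e1, variance_add_const hD.aestronglyMeasurable, e2,
      variance_sub_const hDW.aestronglyMeasurable]
    rfl
  have hlin := tendstoInDistribution_halves hξη hξid hηid hξ2 hη2 hξ0 hη0 hn₁ hn₂ hm₁ hm₂
    (tendsto_sqrt_div_mul_sqrt hn₁ hζ0' hn₁N) (tendsto_sqrt_div_mul_sqrt hn₂ hζ0' hn₂N)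
    (tendsto_sqrt_div_mul_sqrt hm₁ hζ1' hm₁N) (tendsto_sqrt_div_mul_sqrt hm₂ hζ1' hm₂N)
  have hvar : 2 * (1 / 2 * (√(ζ / 2))⁻¹) ^ 2 * Var[ξ 0; P]
      + 2 * (1 / 2 * (√((1 - ζ) / 2))⁻¹) ^ 2 * Var[η 0; P] = asympVar X α ζ p q := by
    have h1ζ : 1 - ζ ≠ 0 := by linarith
    rw [mul_pow, mul_pow, inv_pow, inv_pow, Real.sq_sqrt hζ0'.le, Real.sq_sqrt hζ1'.le, hvξ, hvη,
      asympVar]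
    field_simp
  rw [hvar] at hlin
  -- the remainder
  obtain ⟨C, -, hC⟩ := exists_integral_abs_linRemainder_le_mise hB' hα1 hX hpm hqm hp hq hp1 hq1
    hVm hWm hV hW hind hphm hqhm hph hqh
  let R₁ : ℕ → Ω → ℝ := fun k ω => linRemainder X α p q
    (phat _ (firstHalf (n k) fun i => V i ω)) (qhat _ (firstHalf (m k) fun j => W j ω))
    (secondHalf (n k) fun i => V i ω) (secondHalf (m k) fun j => W j ω)
  let R₂ : ℕ → Ω → ℝ := fun k ω => linRemainder X α p q
    (phat _ (secondHalf (n k) fun i => V i ω)) (qhat _ (secondHalf (m k) fun j => W j ω))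
    (firstHalf (n k) fun i => V i ω) (firstHalf (m k) fun j => W j ω)
  let E₁ : ℕ → ℝ := fun k => mise X p phat (n k / 2) + mise X q qhat (m k / 2)
  let E₂ : ℕ → ℝ := fun k => mise X p phat (n k - n k / 2) + mise X q qhat (m k - m k / 2)
  have hE₁ : Tendsto (fun k => √(N k : ℝ) * E₁ k) atTop (𝓝 0) := by
    simpa [E₁, mul_add] using (tendsto_sqrt_mul_of_div hn₁ hζ0' hn₁N hpr).add
      (tendsto_sqrt_mul_of_div hm₁ hζ1' hm₁N hqr)
  have hE₂ : Tendsto (fun k => √(N k : ℝ) * E₂ k) atTop (𝓝 0) := by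
    simpa [E₂, mul_add] using (tendsto_sqrt_mul_of_div hn₂ hζ0' hn₂N hpr).add
      (tendsto_sqrt_mul_of_div hm₂ hζ1' hm₂N hqr)
  have hbound := ((tendsto_sqrt_mul_remainder_bound hN hζ0' hζ1' hn₂N hm₂N C hE₁).add
    (tendsto_sqrt_mul_remainder_bound hN hζ0' hζ1' hn₁N hm₁N C hE₂)).const_mul (1 / 2)
  rw [add_zero, mul_zero] at hbound
  have hVf : ∀ k, Measurable fun ω => firstHalf k fun i => V i ω := fun k =>
    measurable_pi_lambda _ fun i => hVm _
  have hVs : ∀ k, Measurable fun ω => secondHalf k fun i => V i ω := fun k =>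
    measurable_pi_lambda _ fun i => hVm _
  have hWf : ∀ k, Measurable fun ω => firstHalf k fun i => W i ω := fun k =>
    measurable_pi_lambda _ fun i => hWm _
  have hWs : ∀ k, Measurable fun ω => secondHalf k fun i => W i ω := fun k =>
    measurable_pi_lambda _ fun i => hWm _
  have hY : ∀ k, Measurable fun ω => √((n k + m k : ℕ) : ℝ) *
      (dsEstimator α phat qhat (n k) (m k) (fun i => V i ω) (fun j => W j ω) - tsallis X α p q) :=
    fun k => ((((measurable_prelim α hphm hqhm (hVf _) (hVs _) (hWf _) (hWs _)).add
      (measurable_prelim α hphm hqhm (hVs _) (hVf _) (hWs _) (hWf _))).div_const 2).sub_const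
      _).const_mul _
  refine tendstoInDistribution_of_tendstoInMeasure_sub _ _ hlin
    (tendstoInMeasure_zero_of_integral_abs_le (fun k => ?_) hbound ?_)
    (fun k => (hY k).aemeasurable)
  · exact ((hY k).aemeasurable.sub (hlin.forall_aemeasurable k)).aestronglyMeasurable
  filter_upwards [hn.eventually_gt_atTop 1, hm.eventually_gt_atTop 1] with k hnk hmk
  have hn1 : 0 < n k / 2 := by omega
  have hn2 : 0 < n k - n k / 2 := by omega
  have hm1 : 0 < m k / 2 := by omega
  have hm2 : 0 < m k - m k / 2 := by omega
  obtain ⟨hi₁, hb₁⟩ := hC (n k / 2) (n k - n k / 2) (m k / 2) (m k - m k / 2)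
    (fun i => i) (fun i => n k / 2 + i) (fun j => j) (fun j => m k / 2 + j) hn2 hm2
    Fin.val_injective (fun i j h => Fin.ext (by simpa using h))
    Fin.val_injective (fun i j h => Fin.ext (by simpa using h))
    (fun i j => by have := i.2; omega) (fun i j => by have := i.2; omega)
  obtain ⟨hi₂, hb₂⟩ := hC (n k - n k / 2) (n k / 2) (m k - m k / 2) (m k / 2)
    (fun i => n k / 2 + i) (fun i => i) (fun j => m k / 2 + j) (fun j => j) hn1 hm1
    (fun i j h => Fin.ext (by simpa using h)) Fin.val_injective
    (fun i j h => Fin.ext (by simpa using h)) Fin.val_injective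
    (fun i j => by have := j.2; omega) (fun i j => by have := j.2; omega)
  have hdecomp : ∀ ω, √((n k + m k : ℕ) : ℝ) * (dsEstimator α phat qhat (n k) (m k)
      (fun i => V i ω) (fun j => W j ω) - tsallis X α p q)
      - ((√(N k : ℝ) / (2 * (n k / 2 : ℕ)) * ∑ i ∈ Finset.range (n k / 2), ξ i ω
        + √(N k : ℝ) / (2 * (n k - n k / 2 : ℕ)) *
          ∑ i ∈ Finset.range (n k - n k / 2), ξ (n k / 2 + i) ω)
        + (√(N k : ℝ) / (2 * (m k / 2 : ℕ)) * ∑ j ∈ Finset.range (m k / 2), η j ω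
        + √(N k : ℝ) / (2 * (m k - m k / 2 : ℕ)) *
          ∑ j ∈ Finset.range (m k - m k / 2), η (m k / 2 + j) ω))
      = √(N k : ℝ) * (1 / 2) * (R₁ k ω + R₂ k ω) := by
    intro ω
    simp only [R₁, R₂, linRemainder, dsEstimator, firstHalf, secondHalf, ξ, η, Finset.sum_range,
      Finset.sum_sub_distrib, Finset.sum_const, Finset.card_range, nsmul_eq_mul, N]
    have hn1' : ((n k / 2 : ℕ) : ℝ) ≠ 0 := by positivity
    have hn2' : ((n k - n k / 2 : ℕ) : ℝ) ≠ 0 := by positivity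
    have hm1' : ((m k / 2 : ℕ) : ℝ) ≠ 0 := by positivity
    have hm2' : ((m k - m k / 2 : ℕ) : ℝ) ≠ 0 := by positivity
    generalize ((n k / 2 : ℕ) : ℝ) = x1 at *
    generalize ((n k - n k / 2 : ℕ) : ℝ) = x2 at *
    generalize ((m k / 2 : ℕ) : ℝ) = y1 at *
    generalize ((m k - m k / 2 : ℕ) : ℝ) = y2 at *
    field_simp
    ring
  have hfun : ((fun (k : ℕ) (ω : Ω) => √((n k + m k : ℕ) : ℝ) * (dsEstimator α phat qhat (n k) (m k)
      (fun i => V i ω) (fun j => W j ω) - tsallis X α p q)) - fun (k : ℕ) (ω : Ω) =>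
      ((√(N k : ℝ) / (2 * (n k / 2 : ℕ)) * ∑ i ∈ Finset.range (n k / 2), ξ i ω
        + √(N k : ℝ) / (2 * (n k - n k / 2 : ℕ)) *
          ∑ i ∈ Finset.range (n k - n k / 2), ξ (n k / 2 + i) ω)
        + (√(N k : ℝ) / (2 * (m k / 2 : ℕ)) * ∑ j ∈ Finset.range (m k / 2), η j ω
        + √(N k : ℝ) / (2 * (m k - m k / 2 : ℕ)) *
          ∑ j ∈ Finset.range (m k - m k / 2), η (m k / 2 + j) ω))) k =
      fun ω => √(N k : ℝ) * (1 / 2) * (R₁ k ω + R₂ k ω) := funext hdecomp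
  refine ⟨?_, ?_⟩
  · exact (congrArg (Integrable · P) hfun).mpr ((hi₁.add hi₂).const_mul _)
  · refine (congrArg (fun F : Ω → ℝ => ∫ ω, |F ω| ∂P) hfun).trans_le ?_
    have hs : (0 : ℝ) ≤ √(N k : ℝ) * (1 / 2) := by positivity
    simp only [abs_mul _ (R₁ k _ + R₂ k _), abs_of_nonneg hs]
    rw [integral_const_mul]
    have h : ∫ ω, |R₁ k ω + R₂ k ω| ∂P ≤ (∫ ω, |R₁ k ω| ∂P) + ∫ ω, |R₂ k ω| ∂P := by
      have hi₁' : Integrable (R₁ k) P := hi₁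
      have hi₂' : Integrable (R₂ k) P := hi₂
      rw [← integral_add hi₁'.abs hi₂'.abs]
      exact integral_mono (hi₁'.add hi₂').abs (hi₁'.abs.add hi₂'.abs) fun ω => abs_add_le _ _
    calc _ ≤ √(N k : ℝ) * (1 / 2) * _ :=
          mul_le_mul_of_nonneg_left (h.trans (add_le_add hb₁ hb₂)) hs
      _ = _ := by
        simp only [E₁, E₂]
        ring

end Core

/-! ### Reduction to globally bounded measurable densities and estimators -/

section Reduction

variable {ι : Type} [Fintype ι]

lemma ae_densityLaw_mem {X : Set (Euc ι)} (hX : MeasurableSet X) (p : Euc ι → ℝ) :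
    ∀ᵐ x ∂densityLaw X p, x ∈ X :=
  (withDensity_absolutelyContinuous _ _).ae_le (ae_restrict_mem hX)

lemma densityLaw_congr {X : Set (Euc ι)} (hX : MeasurableSet X) {p p' : Euc ι → ℝ}
    (h : Set.EqOn p p' X) : densityLaw X p = densityLaw X p' := by
  refine withDensity_congr_ae ?_
  filter_upwards [ae_restrict_mem hX] with x hx
  rw [h hx]

lemma powerIntegral_congr {X : Set (Euc ι)} (hX : MeasurableSet X) {p p' q q' : Euc ι → ℝ}
    (α : ℝ) (hp : Set.EqOn p p' X) (hq : Set.EqOn q q' X) :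
    powerIntegral X α p q = powerIntegral X α p' q' :=
  setIntegral_congr_fun hX fun x hx => by simp only [hp hx, hq hx]

lemma asympVar_congr {X : Set (Euc ι)} (hX : MeasurableSet X) {p p' q q' : Euc ι → ℝ} (α ζ : ℝ)
    (hp : Set.EqOn p p' X) (hq : Set.EqOn q q' X) :
    asympVar X α ζ p q = asympVar X α ζ p' q' := by
  have h1 : psiXZ X α p q =ᵐ[densityLaw X p'] psiXZ X α p' q' := by
    filter_upwards [ae_densityLaw_mem hX p'] with x hx
    rw [psiXZ, psiXZ, hp hx, hq hx, powerIntegral_congr hX α hp hq]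
  have h2 : psiYZ X α p q =ᵐ[densityLaw X q'] psiYZ X α p' q' := by
    filter_upwards [ae_densityLaw_mem hX q'] with x hx
    rw [psiYZ, psiYZ, hp hx, hq hx, powerIntegral_congr hX α hp hq]
  rw [asympVar, asympVar, densityLaw_congr hX hp, densityLaw_congr hX hq, variance_congr h1,
    variance_congr h2]

lemma prelim_congr {X : Set (Euc ι)} {α : ℝ} {f f' g g' : Euc ι → ℝ} {k l : ℕ}
    {v : Fin k → Euc ι} {w : Fin l → Euc ι} (hf : Set.EqOn f f' X) (hg : Set.EqOn g g' X)
    (hv : ∀ i, v i ∈ X) (hw : ∀ j, w j ∈ X) : prelim α f g v w = prelim α f' g' v w := by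
  simp only [prelim, hf (hv _), hg (hv _), hf (hw _), hg (hw _)]

/-- Truncation of an estimator at `B'` and `B`. -/
noncomputable def clipEstimator (B' B : ℝ) (phat : DensityEstimator ι) : DensityEstimator ι :=
  fun k v x => max B' (min B (phat k v x))

lemma eqOn_clipEstimator {X : Set (Euc ι)} {B' B : ℝ} {phat : DensityEstimator ι}
    (h : IsBoundedEstimator X B' B phat) (k : ℕ) (v : Fin k → Euc ι) :
    Set.EqOn (clipEstimator B' B phat k v) (phat k v) X := fun x hx => by
  rw [clipEstimator, min_eq_right (h.bounds k v x hx).2, max_eq_right (h.bounds k v x hx).1]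

lemma mise_congr {X : Set (Euc ι)} (hX : MeasurableSet X) {p p' : Euc ι → ℝ}
    (hp : Set.EqOn p p' X) {phat phat' : DensityEstimator ι}
    (h : ∀ k v, Set.EqOn (phat k v) (phat' k v) X) (k : ℕ) :
    mise X p phat k = mise X p' phat' k := by
  rw [mise, mise, densityLaw_congr hX hp]
  congr 1
  funext v
  exact setIntegral_congr_fun hX fun x hx => by simp only [hp hx, h k v hx]

/-- Only values on `X` matter for the functional, so a density that is continuous on `X` may be
replaced by one that is measurable and bounded everywhere. -/
lemma exists_measurable_extension {X : Set (Euc ι)} (hX : MeasurableSet X) {B' B : ℝ}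
    (hBB : B' ≤ B) {r : Euc ι → ℝ} (hrc : ContinuousOn r X) (hr : ∀ x ∈ X, r x ∈ Set.Icc B' B) :
    ∃ r', Measurable r' ∧ (∀ x, r' x ∈ Set.Icc B' B) ∧ Set.EqOn r r' X := by
  classical
  refine ⟨X.piecewise r fun _ => B', hrc.measurable_piecewise continuousOn_const hX,
    fun x => ?_, fun x hx => (Set.piecewise_eq_of_mem _ _ _ hx).symm⟩
  by_cases hx : x ∈ X
  · rw [Set.piecewise_eq_of_mem _ _ _ hx]
    exact hr x hx
  · rw [Set.piecewise_eq_of_notMem _ _ _ hx]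
    exact ⟨le_rfl, hBB⟩

/-- Asymptotic normality when the mean integrated squared errors are `o(k ^ (-1/2))`. -/
theorem dsAsympNormal_of_tendsto_mise {B' B : ℝ} (hB' : 0 < B') {α : ℝ} (hα1 : α ≠ 1)
    {X : Set (Euc ι)} (hX : IsCompact X) {p q : Euc ι → ℝ} (hpc : ContinuousOn p X)
    (hqc : ContinuousOn q X) (hp : ∀ x ∈ X, p x ∈ Set.Icc B' B) (hq : ∀ x ∈ X, q x ∈ Set.Icc B' B)
    (hp1 : ∫ x in X, p x = 1) (hq1 : ∫ x in X, q x = 1)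
    {Ω : Type*} [MeasurableSpace Ω] {P : Measure Ω} [IsProbabilityMeasure P]
    {V W : ℕ → Ω → Euc ι}
    (hV : ∀ i, HasLaw (V i) (densityLaw X p) P) (hW : ∀ j, HasLaw (W j) (densityLaw X q) P)
    (hind : iIndepFun (Sum.elim V W) P) {phat qhat : DensityEstimator ι}
    (hph : IsBoundedEstimator X B' B phat) (hqh : IsBoundedEstimator X B' B qhat)
    (hpr : Tendsto (fun k : ℕ => √(k : ℝ) * mise X p phat k) atTop (𝓝 0))
    (hqr : Tendsto (fun k : ℕ => √(k : ℝ) * mise X q qhat k) atTop (𝓝 0))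
    {ζ : ℝ} (hζ0 : 0 < ζ) (hζ1 : ζ < 1) {n m : ℕ → ℕ}
    (hn : Tendsto n atTop atTop) (hm : Tendsto m atTop atTop)
    (hnm : Tendsto (fun k => (n k : ℝ) / ((n k : ℝ) + (m k : ℝ))) atTop (𝓝 ζ)) :
    DSAsympNormal P V W n m X α ζ p q phat qhat := by
  have hXm := hX.measurableSet
  have hBB : B' ≤ B := by
    rcases X.eq_empty_or_nonempty with rfl | ⟨x, hx⟩
    · simp at hp1
    · exact (hp x hx).1.trans (hp x hx).2
  obtain ⟨p', hp'm, hp'b, hpp'⟩ := exists_measurable_extension hXm hBB hpc hp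
  obtain ⟨q', hq'm, hq'b, hqq'⟩ := exists_measurable_extension hXm hBB hqc hq
  -- measurable versions of the observations
  obtain ⟨V', hV'm, hVV'⟩ : ∃ V' : ℕ → Ω → Euc ι, (∀ i, Measurable (V' i)) ∧
      ∀ i, V i =ᵐ[P] V' i :=
    ⟨_, fun i => (hV i).aemeasurable.measurable_mk, fun i => (hV i).aemeasurable.ae_eq_mk⟩
  obtain ⟨W', hW'm, hWW'⟩ : ∃ W' : ℕ → Ω → Euc ι, (∀ i, Measurable (W' i)) ∧
      ∀ i, W i =ᵐ[P] W' i :=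
    ⟨_, fun i => (hW i).aemeasurable.measurable_mk, fun i => (hW i).aemeasurable.ae_eq_mk⟩
  have hind' : iIndepFun (Sum.elim V' W') P := by
    refine hind.congr ?_
    rintro (i | j)
    · exact hVV' i
    · exact hWW' j
  have hV' : ∀ i, HasLaw (V' i) (densityLaw X p') P := fun i =>
    densityLaw_congr hXm hpp' ▸ (hV i).congr (hVV' i).symm
  have hW' : ∀ i, HasLaw (W' i) (densityLaw X q') P := fun i =>
    densityLaw_congr hXm hqq' ▸ (hW i).congr (hWW' i).symm
  have hclip : ∀ {r : DensityEstimator ι} (k v x), clipEstimator B' B r k v x ∈ Set.Icc B' B :=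
    fun k v x => ⟨le_max_left _ _, max_le hBB (min_le_left _ _)⟩
  have hclipm : ∀ {r : DensityEstimator ι}, IsBoundedEstimator X B' B r → ∀ k,
      Measurable fun a : (Fin k → Euc ι) × Euc ι => clipEstimator B' B r k a.1 a.2 :=
    fun hr k => measurable_const.max (measurable_const.min (hr.measurable k))
  have hmain := dsAsympNormal_of_measurable hB' hα1 hX.measure_lt_top.ne hp'm hq'm hp'b hq'b
    ((setIntegral_congr_fun hXm hpp').symm.trans hp1)
    ((setIntegral_congr_fun hXm hqq').symm.trans hq1)
    hV'm hW'm hV' hW' hind' (hclipm hph) (hclipm hqh) hclip hclip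
    (hpr.congr fun k => by
      rw [mise_congr hXm hpp' fun k v => (eqOn_clipEstimator hph k v).symm])
    (hqr.congr fun k => by
      rw [mise_congr hXm hqq' fun k v => (eqOn_clipEstimator hqh k v).symm])
    hζ0 hζ1 hn hm hnm
  have htsallis : tsallis X α p' q' = tsallis X α p q := by
    rw [tsallis, tsallis, powerIntegral_congr hXm α hpp' hqq']
  simp only [DSAsympNormal, ← asympVar_congr hXm α ζ hpp' hqq', htsallis] at hmain
  have hVX : ∀ᵐ ω ∂P, ∀ i, V i ω ∈ X := ae_all_iff.2 fun i =>
    ((hV i).ae_iff (p := (· ∈ X)) (measurableSet_setOfPred.1 hXm)).2 (ae_densityLaw_mem hXm p)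
  have hWX : ∀ᵐ ω ∂P, ∀ i, W i ω ∈ X := ae_all_iff.2 fun i =>
    ((hW i).ae_iff (p := (· ∈ X)) (measurableSet_setOfPred.1 hXm)).2 (ae_densityLaw_mem hXm q)
  refine hmain.congr (fun k => ?_) .rfl
  filter_upwards [hVX, hWX, ae_all_iff.2 hVV', ae_all_iff.2 hWW'] with ω h1 h2 h3 h4
  have e1 : (fun i => V' i ω) = fun i => V i ω := funext fun i => (h3 i).symm
  have e2 : (fun i => W' i ω) = fun i => W i ω := funext fun i => (h4 i).symm
  simp only [e1, e2, dsEstimator]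
  rw [prelim_congr (v := secondHalf (n k) fun i => V i ω) (w := secondHalf (m k) fun j => W j ω)
      (eqOn_clipEstimator hph _ _) (eqOn_clipEstimator hqh _ _) (fun i => h1 _) (fun i => h2 _),
    prelim_congr (v := firstHalf (n k) fun i => V i ω) (w := firstHalf (m k) fun j => W j ω)
      (eqOn_clipEstimator hph _ _) (eqOn_clipEstimator hqh _ _) (fun i => h1 _) (fun i => h2 _)]

lemma tendsto_sqrt_mul_of_isBigO_rpow {M : ℕ → ℝ} {r : ℝ} (hr : 1 / 2 < r)
    (hM : M =O[atTop] fun k : ℕ => (k : ℝ) ^ (-r)) :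
    Tendsto (fun k : ℕ => √(k : ℝ) * M k) atTop (𝓝 0) := by
  have h1 : (fun k : ℕ => √(k : ℝ) * M k) =O[atTop] fun k : ℕ => √(k : ℝ) * (k : ℝ) ^ (-r) :=
    (isBigO_refl _ _).mul hM
  refine h1.trans_tendsto ?_
  have h2 : Tendsto (fun k : ℕ => (k : ℝ) ^ (-(r - 1 / 2))) atTop (𝓝 0) :=
    (tendsto_rpow_neg_atTop (by linarith)).comp tendsto_natCast_atTop_atTop
  refine h2.congr' ?_
  filter_upwards [eventually_gt_atTop 0] with k hk
  have hk' : (0 : ℝ) < k := by exact_mod_cast hk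
  rw [Real.sqrt_eq_rpow, ← Real.rpow_add hk']
  congr 1
  ring

lemma tendsto_sqrt_mul_mise_of_attainsRate {X : Set (Euc ι)} {s : ℝ} {p : Euc ι → ℝ}
    {phat : DensityEstimator ι} (hs : (Fintype.card ι : ℝ) / 2 < s)
    (h : AttainsRate X s p phat) :
    Tendsto (fun k : ℕ => √(k : ℝ) * mise X p phat k) atTop (𝓝 0) := by
  have hd : (0 : ℝ) ≤ Fintype.card ι := Nat.cast_nonneg _
  refine tendsto_sqrt_mul_of_isBigO_rpow (r := 2 * s / (2 * s + Fintype.card ι)) ?_ ?_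
  · rw [div_lt_div_iff₀ (by norm_num) (by linarith)]
    linarith
  · rw [← neg_div]
    exact h

end Reduction

/-! ### Taylor expansion of Hölder functions on a convex set -/

section Taylor

/-- Taylor's formula for a function with successive derivatives `g 0, …, g l`, when the last one
stays within `M` of its value at `0`. -/
lemma abs_sub_taylor_le {M : ℝ} (l : ℕ) : ∀ g : ℕ → ℝ → ℝ,
    (∀ j < l, ∀ τ ∈ Set.Icc (0 : ℝ) 1, HasDerivWithinAt (g j) (g (j + 1) τ) (Set.Icc 0 1) τ) →
    (∀ τ ∈ Set.Icc (0 : ℝ) 1, |g l τ - g l 0| ≤ M) →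
    ∀ τ ∈ Set.Icc (0 : ℝ) 1,
      |g 0 τ - ∑ j ∈ Finset.range (l + 1), g j 0 * (τ ^ j / (j.factorial : ℝ))| ≤ M := by
  induction l with
  | zero => intro g _ h τ hτ; simpa using h τ hτ
  | succ l ih =>
    intro g hg h τ hτ
    have h0 : (0 : ℝ) ∈ Set.Icc (0 : ℝ) 1 := ⟨le_rfl, zero_le_one⟩
    have hM : 0 ≤ M := (abs_nonneg _).trans (h 0 h0)
    have ih' := ih (fun j => g (j + 1)) (fun j hj => hg (j + 1) (by omega)) h
    have hder : ∀ x ∈ Set.Icc (0 : ℝ) 1, HasDerivWithinAt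
        (fun τ => g 0 τ - ∑ j ∈ Finset.range (l + 2), g j 0 * (τ ^ j / (j.factorial : ℝ)))
        (g 1 x - ∑ j ∈ Finset.range (l + 1), g (j + 1) 0 * (x ^ j / (j.factorial : ℝ)))
        (Set.Icc 0 1) x := by
      intro x hx
      refine (hg 0 (by omega) x hx).fun_sub ?_
      have hs : HasDerivWithinAt
          (fun τ => (∑ j ∈ Finset.range (l + 1),
            g (j + 1) 0 * (τ ^ (j + 1) / ((j + 1).factorial : ℝ)))
            + g 0 0 * (τ ^ 0 / (Nat.factorial 0 : ℝ)))
          (∑ j ∈ Finset.range (l + 1), g (j + 1) 0 * (x ^ j / (j.factorial : ℝ)))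
          (Set.Icc 0 1) x := by
        simp only [pow_zero]
        refine HasDerivWithinAt.add_const _ (HasDerivWithinAt.fun_sum fun j _ => ?_)
        refine (((hasDerivWithinAt_pow (j + 1) x).div_const _).const_mul
          _).congr_deriv ?_
        rw [Nat.factorial_succ]
        have : (j.factorial : ℝ) ≠ 0 := by positivity
        simp only [Nat.add_sub_cancel]
        push_cast
        field_simp
      simpa only [Finset.sum_range_succ' _ (l + 1)] using hs
    have := (convex_Icc (0 : ℝ) 1).norm_image_sub_le_of_norm_hasDerivWithin_le hder
      (fun x hx => ih' x hx) h0 hτ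
    have hz : ∑ j ∈ Finset.range (l + 2), g j 0 * ((0 : ℝ) ^ j / (j.factorial : ℝ)) = g 0 0 := by
      rw [Finset.sum_range_succ']
      simp
    rw [hz, sub_self, sub_zero, sub_zero, Real.norm_eq_abs, Real.norm_eq_abs,
      abs_of_nonneg hτ.1] at this
    exact this.trans (mul_le_of_le_one_right hM hτ.2)

variable {ι : Type} [Fintype ι]

lemma multilinear_apply_const_eq_sum {j : ℕ} (T : (Euc ι) [×j]→L[ℝ] ℝ) (δ : Euc ι) :
    T (fun _ => δ) =
      ∑ c : Fin j → ι, (∏ i, δ (c i)) * T (fun i => EuclideanSpace.basisFun ι ℝ (c i)) := by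
  classical
  have hδ : δ = ∑ i, δ i • EuclideanSpace.basisFun ι ℝ i := by
    conv_lhs => rw [← (EuclideanSpace.basisFun ι ℝ).sum_repr δ]
    simp
  conv_lhs => rw [hδ]
  rw [T.map_sum]
  refine Finset.sum_congr rfl fun c _ => ?_
  rw [T.map_smul_univ, smul_eq_mul]

lemma prod_apply_le_norm_pow {j : ℕ} (δ : Euc ι) (c : Fin j → ι) :
    |∏ i, δ (c i)| ≤ ‖δ‖ ^ j := by
  rw [Finset.abs_prod]
  refine (Finset.prod_le_prod (fun i _ => abs_nonneg _) fun i _ =>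
    PiLp.norm_apply_le δ (c i)).trans_eq ?_
  simp

/-- The Taylor polynomial at `t` of degree `⌊s⌋` approximates a function of smoothness `s` up to
order `s`.  It is written with words `c` of coordinate directions in place of multi-indices. -/
lemma exists_taylor_of_mem_holderClass {X : Set (Euc ι)} (hX : Convex ℝ X) {s L : ℝ} (hs : 0 < s)
    {f : Euc ι → ℝ} (hf : f ∈ HolderClass X s L) :
    ∃ C, 0 ≤ C ∧ ∀ t ∈ X, ∃ A : (j : ℕ) → (Fin j → ι) → ℝ, (∀ c, A 0 c = f t) ∧
      ∀ y ∈ X, |f y - ∑ j ∈ Finset.range (⌊s⌋₊ + 1), ∑ c : Fin j → ι,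
        (∏ i, (y - t) (c i)) * A j c| ≤ C * ‖y - t‖ ^ s := by
  obtain ⟨F, hF, hL⟩ := hf
  set l := ⌊s⌋₊ with hl
  have hls : (l : ℝ) ≤ s := Nat.floor_le hs.le
  refine ⟨Fintype.card (Fin l → ι) * |L|, by positivity, fun t ht => ?_⟩
  refine ⟨fun j c => F t j (fun i => EuclideanSpace.basisFun ι ℝ (c i)) / (j.factorial : ℝ),
    fun c => ?_, fun y hy => ?_⟩
  · have h0 := hF.zero_eq t ht
    simp only [Nat.factorial_zero, Nat.cast_one, div_one, ← h0]
    exact congrArg (F t 0) (Subsingleton.elim _ _)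
  set δ := y - t with hδ
  have hline : ∀ τ ∈ Set.Icc (0 : ℝ) 1, t + τ • δ ∈ X := fun τ hτ =>
    hX.add_smul_sub_mem ht hy hτ
  have hgder : ∀ j < l, ∀ τ ∈ Set.Icc (0 : ℝ) 1, HasDerivWithinAt
      (fun τ => F (t + τ • δ) j (fun _ => δ)) (F (t + τ • δ) (j + 1) (fun _ => δ))
      (Set.Icc 0 1) τ := by
    intro j hj τ hτ
    have h1 := hF.fderivWithin j (by exact_mod_cast hj) _ (hline τ hτ)
    have h2 : HasDerivWithinAt (fun τ : ℝ => t + τ • δ) δ (Set.Icc 0 1) τ := by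
      simpa using ((hasDerivWithinAt_id τ (Set.Icc (0 : ℝ) 1)).smul_const δ).const_add t
    have h3 := h1.comp_hasDerivWithinAt τ h2 hline
    have h4 := (ContinuousMultilinearMap.apply ℝ (fun _ : Fin j => Euc ι) ℝ
      (fun _ => δ)).hasFDerivAt.comp_hasDerivWithinAt τ h3
    refine h4.congr_deriv ?_
    simp only [ContinuousMultilinearMap.apply_apply, ContinuousMultilinearMap.curryLeft_apply]
    congr 1
    funext i
    refine Fin.cases ?_ (fun i => ?_) i <;> simp
  have hglast : ∀ τ ∈ Set.Icc (0 : ℝ) 1, |F (t + τ • δ) l (fun _ => δ)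
      - F (t + (0 : ℝ) • δ) l (fun _ => δ)| ≤ Fintype.card (Fin l → ι) * |L| * ‖δ‖ ^ s := by
    intro τ hτ
    rw [zero_smul, add_zero, multilinear_apply_const_eq_sum, multilinear_apply_const_eq_sum,
      ← Finset.sum_sub_distrib]
    refine (Finset.abs_sum_le_sum_abs _ _).trans ?_
    refine (Finset.sum_le_card_nsmul _ _ (|L| * ‖δ‖ ^ s) fun c _ => ?_).trans_eq ?_
    · rw [← mul_sub, abs_mul]
      have h1 := hL c _ (hline τ hτ) t ht
      have h2 : ‖t + τ • δ - t‖ ≤ ‖δ‖ := by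
        rw [add_sub_cancel_left, norm_smul, Real.norm_of_nonneg hτ.1]
        exact mul_le_of_le_one_left (norm_nonneg _) hτ.2
      have h3 : L * ‖t + τ • δ - t‖ ^ (s - l) ≤ |L| * ‖δ‖ ^ (s - l) := by
        have := Real.rpow_le_rpow (norm_nonneg _) h2 (sub_nonneg.2 hls)
        exact mul_le_mul (le_abs_self L) this (by positivity) (abs_nonneg L)
      calc _ ≤ ‖δ‖ ^ l * (|L| * ‖δ‖ ^ (s - l)) :=
            mul_le_mul (prod_apply_le_norm_pow δ c) (h1.trans h3) (abs_nonneg _) (by positivity)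
        _ = |L| * (‖δ‖ ^ (l : ℝ) * ‖δ‖ ^ (s - l)) := by
            rw [Real.rpow_natCast]
            ring
        _ = |L| * ‖δ‖ ^ s := by
            rw [← Real.rpow_add_of_nonneg (norm_nonneg _) (Nat.cast_nonneg _)
              (sub_nonneg.2 hls)]
            congr 2
            ring
    · rw [nsmul_eq_mul, Finset.card_univ, mul_assoc]
  have key := abs_sub_taylor_le l (fun j τ => F (t + τ • δ) j (fun _ => δ)) hgder hglast 1
    ⟨zero_le_one, le_rfl⟩
  simp only [one_smul, zero_smul, add_zero, one_pow] at key
  have e1 : F (t + δ) 0 (fun _ => δ) = f y := by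
    have h0 := hF.zero_eq y hy
    rw [← h0, hδ, add_sub_cancel]
    exact congrArg (F y 0) (Subsingleton.elim _ _)
  rw [e1] at key
  refine le_of_eq_of_le ?_ key
  congr 2
  refine Finset.sum_congr rfl fun j _ => ?_
  rw [multilinear_apply_const_eq_sum, Finset.sum_mul]
  refine Finset.sum_congr rfl fun c _ => ?_
  ring

end Taylor

/-! ### Mean integrated squared error of truncated kernel density estimators -/

section Kernel

variable {ι : Type} [Fintype ι]

lemma measurableSet_sub_smul_mem {X : Set (Euc ι)} (hX : MeasurableSet X) (t : Euc ι) (h : ℝ) :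
    MeasurableSet {u : Euc ι | t - h • u ∈ X} :=
  hX.preimage (f := fun u => t - h • u) (by fun_prop)

lemma volume_sub_smul_mem_lt_top {X : Set (Euc ι)} (hX : IsCompact X) (t : Euc ι) {h : ℝ}
    (hh : h ≠ 0) : volume {u : Euc ι | t - h • u ∈ X} < ∞ := by
  have hc : IsCompact ((fun x => h⁻¹ • (t - x)) '' X) := hX.image (by fun_prop)
  refine (measure_mono fun u hu => ?_).trans_lt hc.measure_lt_top
  exact ⟨t - h • u, hu, by simp [smul_smul, inv_mul_cancel₀ hh]⟩

lemma setIntegral_eq_smul_setIntegral_sub_smul {X : Set (Euc ι)} (hX : MeasurableSet X)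
    (φ : Euc ι → ℝ) (t : Euc ι) {h : ℝ} (hh : 0 < h) :
    ∫ x in X, φ x = h ^ Fintype.card ι * ∫ u in {u | t - h • u ∈ X}, φ (t - h • u) := by
  rw [← integral_indicator hX, ← integral_indicator (measurableSet_sub_smul_mem hX t h),
    ← integral_sub_left_eq_self _ volume t]
  have := Measure.integral_comp_smul volume (fun x => X.indicator φ (t - x)) h
  rw [finrank_euclideanSpace, abs_of_pos (by positivity), smul_eq_mul] at this
  have e : ∀ u, {u | t - h • u ∈ X}.indicator (fun u => φ (t - h • u)) u =
      X.indicator φ (t - h • u) := fun u => rfl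
  simp_rw [e, this]
  field_simp

lemma integrableOn_of_comp_sub_smul {X : Set (Euc ι)} (hX : MeasurableSet X)
    {φ : Euc ι → ℝ} (t : Euc ι) {h : ℝ} (hh : h ≠ 0)
    (hφ : IntegrableOn (fun u => φ (t - h • u)) {u | t - h • u ∈ X}) : IntegrableOn φ X := by
  rw [← integrable_indicator_iff (measurableSet_sub_smul_mem hX t h)] at hφ
  rw [← integrable_indicator_iff hX, ← integrable_comp_sub_left _ t]
  exact (integrable_comp_smul_iff volume (fun x => X.indicator φ (t - x)) hh).1 hφ

/-- A kernel with integral one and vanishing moments up to order `l` integrates the monomial of a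
word `c` of coordinate directions to one if `c` is empty and to zero otherwise: the exponents `r` of
the monomial count the letters of `c`. -/
lemma setIntegral_prod_mul_kernel {A : Set (Euc ι)} {k : Euc ι → ℝ} {l : ℕ}
    (h1 : ∫ u in A, k u = 1)
    (hmom : ∀ r : ι → ℕ, 1 ≤ ∑ i, r i → ∑ i, r i ≤ l → ∫ u in A, (∏ i, u i ^ r i) * k u = 0)
    {j : ℕ} (hj : j ≤ l) (c : Fin j → ι) :
    ∫ u in A, (∏ i, u (c i)) * k u = if j = 0 then 1 else 0 := by
  classical
  split_ifs with h0
  · subst h0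
    simpa using h1
  · have hprod : ∀ u : Euc ι,
        ∏ i, u (c i) = ∏ i, u i ^ (Finset.univ.filter fun m => c m = i).card := fun u => by
        rw [← Finset.prod_fiberwise' Finset.univ c (fun i => u i)]
        simp
    have hsum : ∑ i, (Finset.univ.filter fun m => c m = i).card = j := by
      rw [← Finset.card_eq_sum_card_fiberwise (s := Finset.univ) (f := c)
        (t := Finset.univ) (fun x _ => Finset.mem_univ _)]
      simp
    simp_rw [hprod]
    exact hmom _ (by omega) (by omega)

/-- The smoothing bias of a kernel of order `⌊s⌋` is of order `h ^ s`. -/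
lemma exists_abs_smoothing_bias_le {X : Set (Euc ι)} (hX : IsCompact X) (hXc : Convex ℝ X)
    {s L B' B : ℝ} (hs : 0 < s) {f : Euc ι → ℝ} (hfm : Measurable f) (hB' : 0 < B')
    (hfb : ∀ x, f x ∈ Set.Icc B' B) (hf : f ∈ HolderClass X s L) :
    ∃ C, 0 ≤ C ∧ ∀ t ∈ X, ∀ h : ℝ, 0 < h → ∀ (k : Euc ι → ℝ) (M : ℝ), Measurable k →
      IntegrableOn k {u | t - h • u ∈ X} →
      IntegrableOn (fun u => ‖u‖ ^ s * |k u|) {u | t - h • u ∈ X} →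
      ∫ u in {u | t - h • u ∈ X}, ‖u‖ ^ s * |k u| ≤ M →
      ∫ u in {u | t - h • u ∈ X}, k u = 1 →
      (∀ r : ι → ℕ, 1 ≤ ∑ i, r i → ∑ i, r i ≤ ⌊s⌋₊ →
        ∫ u in {u | t - h • u ∈ X}, (∏ i, u i ^ r i) * k u = 0) →
      |(∫ u in {u | t - h • u ∈ X}, f (t - h • u) * k u) - f t| ≤ C * h ^ s * M := by
  obtain ⟨C, hC0, hC⟩ := exists_taylor_of_mem_holderClass hXc hs hf
  refine ⟨C, hC0, fun t ht h hh k M hkm hk1 hks hM hk hmom => ?_⟩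
  obtain ⟨a, ha0, ha⟩ := hC t ht
  set A := {u : Euc ι | t - h • u ∈ X} with hA
  have hAm : MeasurableSet A := measurableSet_sub_smul_mem hX.measurableSet t h
  have hls : (⌊s⌋₊ : ℝ) ≤ s := Nat.floor_le hs.le
  have hmono : ∀ j ≤ ⌊s⌋₊, ∀ c : Fin j → ι, IntegrableOn (fun u => (∏ i, u (c i)) * k u) A := by
    intro j hj c
    refine (hk1.abs.add hks).mono' ?_ (.of_forall fun u => ?_)
    · exact ((Finset.measurable_prod _ fun i _ => by fun_prop).mul hkm).aestronglyMeasurable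
    · rw [Real.norm_eq_abs, abs_mul]
      have h1 : |∏ i, u (c i)| ≤ 1 + ‖u‖ ^ s := by
        refine (prod_apply_le_norm_pow u c).trans ?_
        have hjs : (j : ℝ) ≤ s := (Nat.cast_le.2 hj).trans hls
        rcases le_total ‖u‖ 1 with hu | hu
        · have := pow_le_one₀ (n := j) (norm_nonneg u) hu
          have : 0 ≤ ‖u‖ ^ s := by positivity
          linarith
        · have := Real.rpow_le_rpow_of_exponent_le hu hjs
          rw [Real.rpow_natCast] at this
          linarith
      calc _ ≤ (1 + ‖u‖ ^ s) * |k u| := by gcongr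
        _ = _ := by simp only [Pi.add_apply]; ring
  have hterm : ∀ j (c : Fin j → ι) (u : Euc ι), (∏ i, (t - h • u - t) (c i)) * a j c * k u =
      ((-h) ^ j * a j c) * ((∏ i, u (c i)) * k u) := by
    intro j c u
    have : ∏ i, (t - h • u - t) (c i) = (-h) ^ j * ∏ i, u (c i) := by
      simp [sub_sub_cancel_left, Finset.prod_const, ← neg_mul, Finset.prod_mul_distrib]
    rw [this]
    ring
  let poly : Euc ι → ℝ := fun u => ∑ j ∈ Finset.range (⌊s⌋₊ + 1), ∑ c : Fin j → ι,
    (∏ i, (t - h • u - t) (c i)) * a j c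
  have hpolyk : ∀ u, poly u * k u = ∑ j ∈ Finset.range (⌊s⌋₊ + 1), ∑ c : Fin j → ι,
      ((-h) ^ j * a j c) * ((∏ i, u (c i)) * k u) := fun u => by
    simp only [poly, Finset.sum_mul, hterm]
  have hint : ∀ j ∈ Finset.range (⌊s⌋₊ + 1), ∀ c ∈ (Finset.univ : Finset (Fin j → ι)),
      Integrable (fun u => ((-h) ^ j * a j c) * ((∏ i, u (c i)) * k u)) (volume.restrict A) :=
    fun j hj c _ => (hmono j (Nat.lt_succ_iff.1 (Finset.mem_range.1 hj)) c).const_mul _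
  have hpi : Integrable (fun u => poly u * k u) (volume.restrict A) := by
    simp_rw [hpolyk]
    exact integrable_finsetSum _ fun j hj => integrable_finsetSum _ fun c hc => hint j hj c hc
  have hpv : ∫ u in A, poly u * k u = f t := by
    simp_rw [hpolyk]
    rw [integral_finsetSum _ fun j hj => integrable_finsetSum _ fun c hc => hint j hj c hc]
    rw [Finset.sum_eq_single 0]
    · rw [integral_finsetSum _ fun c hc => hint 0 (by simp) c hc]
      simp only [integral_const_mul, setIntegral_prod_mul_kernel hk hmom (Nat.zero_le _), ha0]
      simp
    · intro j hj hj0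
      rw [integral_finsetSum _ fun c hc => hint j hj c hc]
      refine Finset.sum_eq_zero fun c _ => ?_
      rw [integral_const_mul, setIntegral_prod_mul_kernel hk hmom
        (Nat.lt_succ_iff.1 (Finset.mem_range.1 hj)), if_neg hj0, mul_zero]
    · simp
  have hfi : Integrable (fun u => f (t - h • u) * k u) (volume.restrict A) := by
    refine hk1.bdd_mul (c := B) (hfm.comp (by fun_prop)).aestronglyMeasurable
      (.of_forall fun u => ?_)
    rw [Real.norm_of_nonneg (hB'.le.trans (hfb _).1)]
    exact (hfb _).2
  rw [← hpv, ← integral_sub hfi hpi, ← Real.norm_eq_abs]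
  refine (norm_integral_le_of_norm_le (hks.const_mul (C * h ^ s)) ?_).trans ?_
  · filter_upwards [ae_restrict_mem hAm] with u hu
    rw [← sub_mul, norm_mul, Real.norm_eq_abs, Real.norm_eq_abs, ← mul_assoc]
    have h1 := ha _ hu
    have h2 : ‖t - h • u - t‖ ^ s = h ^ s * ‖u‖ ^ s := by
      rw [sub_sub_cancel_left, norm_neg, norm_smul, Real.norm_of_nonneg hh.le,
        Real.mul_rpow hh.le (norm_nonneg _)]
    rw [h2, ← mul_assoc] at h1
    exact mul_le_mul_of_nonneg_right h1 (abs_nonneg _)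
  · rw [integral_const_mul]
    have : 0 ≤ C * h ^ s := by positivity
    gcongr

lemma densityLaw_le {X : Set (Euc ι)} {p : Euc ι → ℝ} {B : ℝ} (hp : ∀ x, p x ≤ B) :
    densityLaw X p ≤ ENNReal.ofReal B • volume.restrict X := by
  rw [← withDensity_const]
  exact withDensity_mono (.of_forall fun x => ENNReal.ofReal_le_ofReal (hp x))

/-- Bias and variance of an empirical average. -/
lemma integral_sq_mean_sub_const_le {E : Type*} [MeasurableSpace E] (μ : Measure E)
    [IsProbabilityMeasure μ] {g : E → ℝ} (hg : MemLp g 2 μ) {k : ℕ} (hk : 0 < k) (a : ℝ) :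
    Integrable (fun x => ((1 / (k : ℝ)) * ∑ i, g (x i) - a) ^ 2)
      (Measure.pi fun _ : Fin k => μ) ∧
    ∫ x, ((1 / (k : ℝ)) * ∑ i, g (x i) - a) ^ 2 ∂(Measure.pi fun _ : Fin k => μ)
      ≤ 2 * ((1 / (k : ℝ)) * ∫ y, g y ^ 2 ∂μ) + 2 * ((∫ y, g y ∂μ) - a) ^ 2 := by
  have hmem : ∀ b : ℝ, MemLp (fun x : Fin k → E => (1 / (k : ℝ)) * ∑ i, g (x i) - b) 2
      (Measure.pi fun _ : Fin k => μ) := fun b =>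
    ((memLp_finsetSum _ fun i _ => hg.comp_measurePreserving
      (measurePreserving_eval (fun _ : Fin k => μ) i)).const_mul _).sub (memLp_const b)
  refine ⟨(hmem a).integrable_sq, ?_⟩
  have h1 := integral_sq_mean_sub_le μ hg hk
  have hi := (hmem (∫ y, g y ∂μ)).integrable_sq
  calc _ ≤ ∫ x, (2 * ((1 / (k : ℝ)) * ∑ i, g (x i) - ∫ y, g y ∂μ) ^ 2
        + 2 * ((∫ y, g y ∂μ) - a) ^ 2) ∂(Measure.pi fun _ : Fin k => μ) := by
        refine integral_mono (hmem a).integrable_sq ((hi.const_mul 2).add (integrable_const _))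
          fun x => ?_
        dsimp only
        nlinarith [sq_nonneg (((1 / (k : ℝ)) * ∑ i, g (x i) - ∫ y, g y ∂μ)
          - ((∫ y, g y ∂μ) - a))]
    _ ≤ _ := by
        rw [integral_add (hi.const_mul 2) (integrable_const _), integral_const_mul]
        simp only [integral_const, probReal_univ, one_smul]
        gcongr

/-- The mean squared error of a kernel density estimate at a point of `X`. -/
lemma exists_integral_sq_kde_sub_le {X : Set (Euc ι)} (hX : IsCompact X) (hXc : Convex ℝ X)
    {s L B' B : ℝ} (hs : 0 < s) {p : Euc ι → ℝ} (hpm : Measurable p) (hB' : 0 < B')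
    (hpb : ∀ x, p x ∈ Set.Icc B' B) (hp : p ∈ HolderClass X s L) (hp1 : ∫ x in X, p x = 1)
    {K : ℝ → Euc ι → Euc ι → ℝ} (hK : IsSmoothingKernel X s K) :
    ∃ h₀ > 0, ∃ C, 0 ≤ C ∧ ∀ h, 0 < h → h ≤ h₀ → ∀ t ∈ X, ∀ k : ℕ, 0 < k →
      Integrable (fun v => (kde K h v t - p t) ^ 2)
        (Measure.pi fun _ : Fin k => densityLaw X p) ∧
      ∫ v, (kde K h v t - p t) ^ 2 ∂(Measure.pi fun _ : Fin k => densityLaw X p)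
        ≤ C * (1 / ((k : ℝ) * h ^ Fintype.card ι)) + C * (h ^ s) ^ 2 := by
  obtain ⟨h₀, hh₀, M, hM⟩ := hK.moments
  obtain ⟨C, hC0, hC⟩ := exists_abs_smoothing_bias_le hX hXc hs hpm hB' hpb hp
  have hB : 0 < B := hB'.trans_le ((hpb 0).1.trans (hpb 0).2)
  have hp0 : ∀ x, 0 ≤ p x := fun x => hB'.le.trans (hpb x).1
  have hμ : IsProbabilityMeasure (densityLaw X p) :=
    isProbabilityMeasure_densityLaw (.of_forall hp0) hp1
  refine ⟨h₀, hh₀, 2 * (B * |M|) + 2 * (C * M) ^ 2, by positivity, fun h hh hhh t ht k hk => ?_⟩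
  obtain ⟨hK2, hK2M, hKs, hKsM, hK1, hKmom⟩ := hM h hh hhh t ht
  set A := {u : Euc ι | t - h • u ∈ X} with hA
  have hhd : 0 < h ^ Fintype.card ι := by positivity
  have hkm : Measurable (K h t) := (hK.measurable h).comp measurable_prodMk_left
  have hfin : IsFiniteMeasure (volume.restrict A) :=
    isFiniteMeasure_restrict.2 (volume_sub_smul_mem_lt_top hX t hh.ne').ne
  have hKi : IntegrableOn (K h t) A := by
    refine (hK2.add (integrable_const 1)).mono' hkm.aestronglyMeasurable (.of_forall fun u => ?_)
    rw [Real.norm_eq_abs, Pi.add_apply]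
    nlinarith [sq_nonneg (|K h t u| - 1), sq_abs (K h t u), abs_nonneg (K h t u)]
  have hbias := hC t ht h hh (K h t) M hkm hKi hKs hKsM hK1 hKmom
  let g : Euc ι → ℝ := fun x => (h ^ Fintype.card ι)⁻¹ * K h t (h⁻¹ • (t - x))
  have hgm : Measurable g := (hkm.comp (by fun_prop)).const_mul _
  have hsub : ∀ u : Euc ι, g (t - h • u) = (h ^ Fintype.card ι)⁻¹ * K h t u := fun u => by
    simp [g, smul_smul, inv_mul_cancel₀ hh.ne']
  have hg2 : MemLp g 2 (densityLaw X p) := by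
    refine (memLp_two_iff_integrable_sq hgm.aestronglyMeasurable).2 ?_
    have h1 : IntegrableOn (fun x => g x ^ 2) X := by
      refine integrableOn_of_comp_sub_smul hX.measurableSet t hh.ne' ?_
      simp_rw [hsub, mul_pow]
      exact hK2.const_mul _
    exact (h1.smul_measure ENNReal.ofReal_ne_top).mono_measure (densityLaw_le fun x => (hpb x).2)
  have hmean : ∫ x, g x ∂densityLaw X p = ∫ u in A, p (t - h • u) * K h t u := by
    rw [integral_densityLaw hpm.aemeasurable (.of_forall hp0),
      setIntegral_eq_smul_setIntegral_sub_smul hX.measurableSet _ t hh, ← integral_const_mul]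
    refine integral_congr_ae (.of_forall fun u => ?_)
    simp only [hsub]
    field_simp
  have hsq : ∫ x, g x ^ 2 ∂densityLaw X p ≤ B * |M| * (h ^ Fintype.card ι)⁻¹ := by
    rw [integral_densityLaw hpm.aemeasurable (.of_forall hp0),
      setIntegral_eq_smul_setIntegral_sub_smul hX.measurableSet _ t hh, ← integral_const_mul]
    calc _ ≤ ∫ u in A, (B * (h ^ Fintype.card ι)⁻¹) * K h t u ^ 2 := by
          refine integral_mono_of_nonneg (.of_forall fun u => ?_) (hK2.const_mul _)
            (.of_forall fun u => ?_)
          · exact mul_nonneg hhd.le (mul_nonneg (hp0 _) (sq_nonneg _))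
          · dsimp only
            rw [hsub]
            calc _ = p (t - h • u) * ((h ^ Fintype.card ι)⁻¹ * K h t u ^ 2) := by field_simp
              _ ≤ B * ((h ^ Fintype.card ι)⁻¹ * K h t u ^ 2) := by
                gcongr
                exact (hpb _).2
              _ = _ := by ring
      _ = B * (h ^ Fintype.card ι)⁻¹ * ∫ u in A, K h t u ^ 2 := integral_const_mul _ _
      _ ≤ B * (h ^ Fintype.card ι)⁻¹ * |M| := by
          gcongr
          exact hK2M.trans (le_abs_self M)
      _ = _ := by ring
  have hkde : ∀ v : Fin k → Euc ι, kde K h v t = (1 / (k : ℝ)) * ∑ i, g (v i) := fun v => by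
    simp only [kde, g, ← Finset.mul_sum]
    field_simp
  simp_rw [hkde]
  obtain ⟨hint, hle⟩ := integral_sq_mean_sub_const_le (densityLaw X p) hg2 hk (p t)
  refine ⟨hint, hle.trans ?_⟩
  rw [hmean]
  have hb2 : ((∫ u in A, p (t - h • u) * K h t u) - p t) ^ 2 ≤ (C * M) ^ 2 * (h ^ s) ^ 2 := by
    rw [← mul_pow, ← sq_abs]
    calc _ ≤ (C * h ^ s * M) ^ 2 := by gcongr
      _ = _ := by ring
  have hv2 : (1 / (k : ℝ)) * ∫ y, g y ^ 2 ∂densityLaw X p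
      ≤ B * |M| * (1 / ((k : ℝ) * h ^ Fintype.card ι)) := by
    calc _ ≤ (1 / (k : ℝ)) * (B * |M| * (h ^ Fintype.card ι)⁻¹) := by gcongr
      _ = _ := by field_simp
  have e1 : 0 ≤ (1 / ((k : ℝ) * h ^ Fintype.card ι)) := by positivity
  have e2 : 0 ≤ (h ^ s) ^ 2 := by positivity
  have e3 : 0 ≤ B * |M| := by positivity
  nlinarith [mul_nonneg (sq_nonneg (C * M)) e1, mul_nonneg e3 e2]

lemma isBoundedEstimator_truncKDE {X : Set (Euc ι)} {s B' B : ℝ} (hBB : B' ≤ B)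
    {K : ℝ → Euc ι → Euc ι → ℝ} (hK : IsSmoothingKernel X s K) (h : ℕ → ℝ) :
    IsBoundedEstimator X B' B (truncKDE K h B' B) where
  measurable k := by
    refine measurable_const.max (measurable_const.min ?_)
    unfold kde
    refine (Finset.measurable_sum _ fun i _ => ?_).const_mul _
    exact (hK.measurable (h k)).comp (measurable_snd.prodMk (by fun_prop))
  bounds k v x _ := ⟨le_max_left _ _, max_le hBB (min_le_left _ _)⟩

lemma sq_clip_sub_le {B' B x y : ℝ} (hy : y ∈ Set.Icc B' B) :
    (max B' (min B x) - y) ^ 2 ≤ (x - y) ^ 2 := by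
  rw [sq_le_sq]
  have h : max B' (min B y) = y := by rw [min_eq_right hy.2, max_eq_right hy.1]
  conv_lhs => rw [← h]
  rw [max_comm B', max_comm B']
  refine (abs_max_sub_max_le_abs _ _ _).trans ((abs_min_sub_min_le_max B x B y).trans ?_)
  simp

/-- A uniform bound for the pointwise mean squared error on `X` bounds the mean integrated one, by
Fubini's theorem. -/
lemma mise_truncKDE_le {X : Set (Euc ι)} (hX : IsCompact X) {B' B : ℝ} {p : Euc ι → ℝ}
    (hpm : Measurable p) (hB' : 0 < B') (hpb : ∀ x, p x ∈ Set.Icc B' B) (hp1 : ∫ x in X, p x = 1)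
    {s : ℝ} {K : ℝ → Euc ι → Euc ι → ℝ} (hK : IsSmoothingKernel X s K) {h : ℕ → ℝ} {k : ℕ} {c : ℝ}
    (hc : ∀ t ∈ X, Integrable (fun v => (kde K (h k) v t - p t) ^ 2)
        (Measure.pi fun _ : Fin k => densityLaw X p) ∧
      ∫ v, (kde K (h k) v t - p t) ^ 2 ∂(Measure.pi fun _ : Fin k => densityLaw X p) ≤ c) :
    mise X p (truncKDE K h B' B) k ≤ c * volume.real X := by
  have hBB : B' ≤ B := (hpb 0).1.trans (hpb 0).2
  have hμ : IsProbabilityMeasure (densityLaw X p) :=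
    isProbabilityMeasure_densityLaw (.of_forall fun x => hB'.le.trans (hpb x).1) hp1
  have hfin : IsFiniteMeasure (volume.restrict X) :=
    isFiniteMeasure_restrict.2 hX.measure_lt_top.ne
  have hm := (isBoundedEstimator_truncKDE (B' := B') hBB hK h).measurable k
  have hint : Integrable (Function.uncurry fun (v : Fin k → Euc ι) t =>
      (truncKDE K h B' B k v t - p t) ^ 2)
      ((Measure.pi fun _ : Fin k => densityLaw X p).prod (volume.restrict X)) := by
    refine .of_bound (((hm.sub (hpm.comp measurable_snd)).pow_const 2).aestronglyMeasurable)
      ((B - B') ^ 2) (.of_forall fun a => ?_)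
    rw [Function.uncurry_def, Real.norm_of_nonneg (sq_nonneg _)]
    exact sq_sub_le_sq_sub ⟨le_max_left _ _, max_le hBB (min_le_left _ _)⟩ (hpb _)
  rw [mise, integral_integral_swap hint]
  refine (Real.le_norm_self _).trans ?_
  refine norm_setIntegral_le_of_norm_le_const hX.measure_lt_top fun t ht => ?_
  rw [Real.norm_of_nonneg (integral_nonneg fun v => sq_nonneg _)]
  exact (integral_mono_of_nonneg (.of_forall fun v => sq_nonneg _) (hc t ht).1
    (.of_forall fun v => sq_clip_sub_le (hpb t))).trans (hc t ht).2

/-- The bandwidth `k ^ (-1 / (2 s + d))` balances variance and squared bias. -/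
lemma isBigO_bandwidth {s : ℝ} (hs : 0 < s) {d : ℕ} {h : ℕ → ℝ}
    (hhΘ : h =Θ[atTop] fun k : ℕ => (k : ℝ) ^ (-1 / (2 * s + d))) (C : ℝ) :
    (fun k : ℕ => C * (1 / ((k : ℝ) * h k ^ d)) + C * (h k ^ s) ^ 2) =O[atTop]
      fun k : ℕ => (k : ℝ) ^ (-(2 * s) / (2 * s + d)) := by
  have hd : 0 < 2 * s + (d : ℝ) := by positivity
  refine IsBigO.add (IsBigO.const_mul_left ?_ _) (IsBigO.const_mul_left ?_ _)
  · have h1 : (fun k : ℕ => 1 / ((k : ℝ) * h k ^ d)) =Θ[atTop]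
        fun k : ℕ => 1 / ((k : ℝ) * ((k : ℝ) ^ (-1 / (2 * s + d))) ^ d) :=
      (isTheta_refl _ _).div ((isTheta_refl _ _).mul (hhΘ.pow d))
    refine h1.1.trans_eventuallyEq ?_
    filter_upwards [eventually_gt_atTop 0] with k hk
    have hk' : (0 : ℝ) < k := by exact_mod_cast hk
    rw [← Real.rpow_natCast, ← Real.rpow_mul hk'.le]
    nth_rewrite 1 [← Real.rpow_one (k : ℝ)]
    rw [← Real.rpow_add hk', one_div, ← Real.rpow_neg hk'.le]
    congr 1
    field_simp
    ring
  · have h1 := ((hhΘ.1.rpow hs.le (.of_forall fun k => by positivity)).pow 2)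
    refine h1.trans_eventuallyEq ?_
    filter_upwards [eventually_gt_atTop 0] with k hk
    have hk' : (0 : ℝ) < k := by exact_mod_cast hk
    rw [← Real.rpow_natCast, ← Real.rpow_mul hk'.le, ← Real.rpow_mul hk'.le]
    congr 1
    push_cast
    field_simp

/-- Kernel density estimators with bandwidths of order `k ^ (-1 / (2 s + d))` attain the rate
`k ^ (-2 s / (2 s + d))`. -/
theorem attainsRate_truncKDE {X : Set (Euc ι)} (hX : IsCompact X) (hXc : Convex ℝ X)
    {s L B' B : ℝ} (hs : 0 < s) {p : Euc ι → ℝ} (hB' : 0 < B')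
    (hp : p ∈ BoundedHolderClass X s L B' B) (hp1 : ∫ x in X, p x = 1)
    {K : ℝ → Euc ι → Euc ι → ℝ} (hK : IsSmoothingKernel X s K) {h : ℕ → ℝ} (hh : ∀ k, 0 < h k)
    (hhΘ : h =Θ[atTop] fun k : ℕ => (k : ℝ) ^ (-1 / (2 * s + Fintype.card ι))) :
    AttainsRate X s p (truncKDE K h B' B) := by
  have hXm := hX.measurableSet
  obtain ⟨hpH, hpb⟩ := hp
  have hpc : ContinuousOn p X := by
    obtain ⟨F, hF, -⟩ := hpH
    exact hF.continuousOn
  have hBB : B' ≤ B := by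
    rcases X.eq_empty_or_nonempty with rfl | ⟨x, hx⟩
    · simp at hp1
    · exact ((hpb x hx).1.trans (hpb x hx).2).le
  obtain ⟨p', hpm', hpb', hpp'⟩ := exists_measurable_extension hXm hBB hpc
    fun x hx => ⟨(hpb x hx).1.le, (hpb x hx).2.le⟩
  have hpH' : p' ∈ HolderClass X s L := by
    obtain ⟨F, hF, hL⟩ := hpH
    exact ⟨F, hF.congr fun x hx => (hpp' hx).symm, hL⟩
  have hp1' : ∫ x in X, p' x = 1 := (setIntegral_congr_fun hXm hpp').symm.trans hp1
  obtain ⟨h₀, hh₀, C, hC0, hC⟩ := exists_integral_sq_kde_sub_le hX hXc hs hpm' hB' hpb' hpH' hp1' hK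
  have hd : 0 < 2 * s + (Fintype.card ι : ℝ) := by positivity
  have hh0 : Tendsto h atTop (𝓝 0) := by
    refine hhΘ.1.trans_tendsto ?_
    rw [neg_div]
    exact (tendsto_rpow_neg_atTop (by positivity)).comp tendsto_natCast_atTop_atTop
  have hbound : (fun k => mise X p (truncKDE K h B' B) k) =O[atTop] fun k : ℕ =>
      (C * (1 / ((k : ℝ) * h k ^ Fintype.card ι)) + C * (h k ^ s) ^ 2) := by
    refine IsBigO.of_bound (volume.real X) ?_
    filter_upwards [eventually_gt_atTop 0, hh0.eventually (eventually_le_nhds hh₀)] with k hk hhk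
    have := hh k
    rw [mise_congr hXm hpp' (fun k v => Set.eqOn_refl _ _) k, Real.norm_of_nonneg (mise_nonneg ..),
      Real.norm_of_nonneg (by positivity), mul_comm]
    exact mise_truncKDE_le hX hpm' hB' hpb' hp1' hK
      fun t ht => hC (h k) (hh k) hhk t ht k hk
  exact hbound.trans (isBigO_bandwidth hs hhΘ C)

end Kernel

/-! ### Nondegeneracy of the limit -/

section Variance

variable {ι : Type} [Fintype ι]

/-- The first influence function already has positive variance: it is constant only if `p / q` is,
and two proportional densities are equal. -/
lemma asympVar_pos_of_measurable {B' B : ℝ} (hB' : 0 < B') {α : ℝ} (hα0 : α ≠ 0) (hα1 : α ≠ 1)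
    {X : Set (Euc ι)} {p q : Euc ι → ℝ} (hpm : Measurable p) (hqm : Measurable q)
    (hp : ∀ x, p x ∈ Set.Icc B' B) (hq : ∀ x, q x ∈ Set.Icc B' B)
    (hp1 : ∫ x in X, p x = 1) (hq1 : ∫ x in X, q x = 1) (hpq : ¬ p =ᵐ[volume.restrict X] q)
    {ζ : ℝ} (hζ0 : 0 < ζ) (hζ1 : ζ < 1) : 0 < asympVar X α ζ p q := by
  have hp0 : ∀ x, 0 < p x := fun x => hB'.trans_le (hp x).1
  have hq0 : ∀ x, 0 < q x := fun x => hB'.trans_le (hq x).1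
  have hμ : IsProbabilityMeasure (densityLaw X p) :=
    isProbabilityMeasure_densityLaw (.of_forall fun x => (hp0 x).le) hp1
  obtain ⟨C, -, hC⟩ := exists_abs_gradFst_le (ι := ι) (B := B) hB' α
  have hA : Measurable (gradFst α p q) := measurable_gradFst α hpm hqm
  have hA2 : MemLp (gradFst α p q) 2 (densityLaw X p) :=
    .of_bound hA.aestronglyMeasurable C (.of_forall fun x => hC p q x (hp x) (hq x))
  have hψ : psiXZ X α p q = fun v => gradFst α p q v - α / (α - 1) * powerIntegral X α p q :=
    funext fun v => psiXZ_eq (hp0 v) (hq0 v)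
  have hvar : 0 < Var[psiXZ X α p q; densityLaw X p] := by
    rw [hψ, variance_sub_const hA.aestronglyMeasurable]
    refine (variance_nonneg _ _).lt_of_ne fun h0 => hpq ?_
    have hconst := ae_eq_integral_of_variance_eq_zero hA2 h0.symm
    have hac : volume.restrict X ≪ densityLaw X p :=
      withDensity_absolutelyContinuous' hpm.ennreal_ofReal.aemeasurable
        (.of_forall fun x => by simpa using hp0 x)
    have hα : α - 1 ≠ 0 := sub_ne_zero.2 hα1
    set c := ∫ x, gradFst α p q x ∂densityLaw X p
    -- a constant influence function makes the ratio of the densities constant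
    have hratio : ∀ᵐ x ∂volume.restrict X, p x = (c / (α / (α - 1))) ^ (α - 1)⁻¹ * q x := by
      filter_upwards [hac.ae_le hconst] with x hx
      have h1 : (p x / q x) ^ (α - 1) = c / (α / (α - 1)) := by
        rw [← hx, gradFst]
        field_simp
      rw [← h1, ← Real.rpow_mul (div_pos (hp0 x) (hq0 x)).le, mul_inv_cancel₀ hα, Real.rpow_one,
        div_mul_cancel₀ _ (hq0 x).ne']
    have h1 := integral_congr_ae hratio
    rw [integral_const_mul, hp1, hq1, mul_one] at h1
    filter_upwards [hratio] with x hx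
    rw [hx, ← h1, one_mul]
  have h2 := variance_nonneg (psiYZ X α p q) (densityLaw X q)
  have h3 : 0 < 1 - ζ := by linarith
  have h4 : 0 ≤ 1 / (1 - ζ) * Var[psiYZ X α p q; densityLaw X q] := by positivity
  have h5 : 0 < 1 / ζ * Var[psiXZ X α p q; densityLaw X p] := by positivity
  rw [asympVar]
  linarith

lemma asympVar_pos {B' B : ℝ} (hB' : 0 < B') {α : ℝ} (hα0 : α ≠ 0) (hα1 : α ≠ 1)
    {X : Set (Euc ι)} (hX : IsCompact X) {p q : Euc ι → ℝ} (hpc : ContinuousOn p X)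
    (hqc : ContinuousOn q X) (hp : ∀ x ∈ X, p x ∈ Set.Icc B' B) (hq : ∀ x ∈ X, q x ∈ Set.Icc B' B)
    (hp1 : ∫ x in X, p x = 1) (hq1 : ∫ x in X, q x = 1) (hpq : ¬ p =ᵐ[volume.restrict X] q)
    {ζ : ℝ} (hζ0 : 0 < ζ) (hζ1 : ζ < 1) : 0 < asympVar X α ζ p q := by
  have hXm := hX.measurableSet
  have hBB : B' ≤ B := by
    rcases X.eq_empty_or_nonempty with rfl | ⟨x, hx⟩
    · simp at hp1
    · exact (hp x hx).1.trans (hp x hx).2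
  obtain ⟨p', hp'm, hp'b, hpp'⟩ := exists_measurable_extension hXm hBB hpc hp
  obtain ⟨q', hq'm, hq'b, hqq'⟩ := exists_measurable_extension hXm hBB hqc hq
  rw [asympVar_congr hXm α ζ hpp' hqq']
  refine asympVar_pos_of_measurable hB' hα0 hα1 hp'm hq'm hp'b hq'b
    ((setIntegral_congr_fun hXm hpp').symm.trans hp1)
    ((setIntegral_congr_fun hXm hqq').symm.trans hq1) (fun h => hpq ?_) hζ0 hζ1
  filter_upwards [h, ae_restrict_mem hXm] with x hx hxX
  rw [hpp' hxX, hx, hqq' hxX]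

end Variance

/-! ### The conditional form of the divergence -/

section Conditional

variable {a b : ℕ}

/-- The measurable equivalence `(u, z) ↦ joint u z`. -/
noncomputable def jointEquiv : Euc (Fin a) × Euc (Fin b) ≃ᵐ Euc (Fin a ⊕ Fin b) :=
  ((MeasurableEquiv.toLp 2 (Fin a → ℝ)).symm.prodCongr
    (MeasurableEquiv.toLp 2 (Fin b → ℝ)).symm).trans
    ((MeasurableEquiv.sumPiEquivProdPi fun _ : Fin a ⊕ Fin b => ℝ).symm.trans
      (MeasurableEquiv.toLp 2 (Fin a ⊕ Fin b → ℝ)))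

lemma jointEquiv_apply (u : Euc (Fin a)) (z : Euc (Fin b)) :
    jointEquiv (u, z) = joint u z := by
  ext i
  rcases i with i | i <;> rfl

lemma measurePreserving_jointEquiv :
    MeasurePreserving (jointEquiv (a := a) (b := b)) (volume.prod volume) volume :=
  (((EuclideanSpace.volume_preserving_symm_measurableEquiv_toLp (Fin a)).prod
    (EuclideanSpace.volume_preserving_symm_measurableEquiv_toLp (Fin b))).trans
    (volume_measurePreserving_sumPiEquivProdPi_symm fun _ : Fin a ⊕ Fin b => ℝ)).trans
    (EuclideanSpace.volume_preserving_symm_measurableEquiv_toLp (Fin a ⊕ Fin b)).symm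

lemma measurableSet_joint_mem {X : Set (Euc (Fin a ⊕ Fin b))} (hX : MeasurableSet X)
    (z : Euc (Fin b)) : MeasurableSet {u : Euc (Fin a) | joint u z ∈ X} := by
  have h : Measurable fun u : Euc (Fin a) => joint u z := by
    simp_rw [← jointEquiv_apply]
    exact jointEquiv.measurable.comp measurable_prodMk_right
  exact hX.preimage h

/-- Fubini's theorem for an integral over `X`, with the integral over the fibres `{u | (u, z) ∈ X}`
inside. -/
lemma fubini_joint {X : Set (Euc (Fin a ⊕ Fin b))} (hX : MeasurableSet X)
    {φ : Euc (Fin a ⊕ Fin b) → ℝ} (hφ : IntegrableOn φ X) :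
    (∀ᵐ z : Euc (Fin b), IntegrableOn (fun u : Euc (Fin a) => φ (joint u z)) {u | joint u z ∈ X}) ∧
    Integrable (fun z : Euc (Fin b) => ∫ u in {u : Euc (Fin a) | joint u z ∈ X}, φ (joint u z)) ∧
    ∫ x in X, φ x = ∫ z : Euc (Fin b), ∫ u in {u : Euc (Fin a) | joint u z ∈ X}, φ (joint u z) := by
  have hi : Integrable (fun y => X.indicator φ (jointEquiv y))
      ((volume : Measure (Euc (Fin a))).prod (volume : Measure (Euc (Fin b)))) :=
    measurePreserving_jointEquiv.integrable_comp_of_integrable ((integrable_indicator_iff hX).2 hφ)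
  have hfib : ∀ z : Euc (Fin b), (fun u : Euc (Fin a) => X.indicator φ (jointEquiv (u, z))) =
      {u : Euc (Fin a) | joint u z ∈ X}.indicator fun u => φ (joint u z) := fun z => by
    funext u
    rw [jointEquiv_apply]
    rfl
  have hint : ∀ z : Euc (Fin b), ∫ u : Euc (Fin a), X.indicator φ (jointEquiv (u, z)) =
      ∫ u in {u : Euc (Fin a) | joint u z ∈ X}, φ (joint u z) := fun z => by
    rw [hfib, integral_indicator (measurableSet_joint_mem hX z)]
  refine ⟨?_, ?_, ?_⟩
  · filter_upwards [hi.prod_left_ae] with z hz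
    rw [hfib] at hz
    exact (integrable_indicator_iff (measurableSet_joint_mem hX z)).1 hz
  · simpa only [hint] using hi.integral_prod_right
  · rw [← integral_indicator hX, ← measurePreserving_jointEquiv.integral_comp'
      (f := jointEquiv), integral_prod_symm _ hi]
    simp only [hint]

/-- Fibres over which the common marginal vanishes are null sets, so that the value `p / 0 = 0` of
the conditional densities there is harmless. -/
lemma condTsallis_eq_tsallis {X : Set (Euc (Fin a ⊕ Fin b))} (hX : IsCompact X) {α : ℝ}
    (hα1 : α ≠ 1) {p q : Euc (Fin a ⊕ Fin b) → ℝ} (hpc : ContinuousOn p X)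
    (hqc : ContinuousOn q X) (hp : ∀ x ∈ X, 0 < p x) (hq : ∀ x ∈ X, 0 < q x)
    (hp1 : ∫ x in X, p x = 1) (hmarg : ∀ᵐ z, marginalZ X p z = marginalZ X q z) :
    condTsallis X α p q = tsallis X α p q := by
  have hα : α - 1 ≠ 0 := sub_ne_zero.2 hα1
  have hα' : 1 - α ≠ 0 := sub_ne_zero.2 hα1.symm
  have hXm := hX.measurableSet
  have hip : IntegrableOn p X := hpc.integrableOn_compact hX
  have hiφ : IntegrableOn (fun x => p x ^ α * q x ^ (1 - α)) X :=
    ((hpc.rpow_const fun x hx => .inl (hp x hx).ne').mul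
      (hqc.rpow_const fun x hx => .inl (hq x hx).ne')).integrableOn_compact hX
  obtain ⟨h1, h2, h3⟩ := fubini_joint hXm hip
  obtain ⟨-, h5, h6⟩ := fubini_joint hXm hiφ
  have hae : ∀ᵐ z, marginalZ X p z * (1 / (α - 1) *
      ((∫ u in {u : Euc (Fin a) | joint u z ∈ X},
        condDensity X p u z ^ α * condDensity X q u z ^ (1 - α)) - 1)) =
      1 / (α - 1) * ((∫ u in {u : Euc (Fin a) | joint u z ∈ X},
        p (joint u z) ^ α * q (joint u z) ^ (1 - α)) - marginalZ X p z) := by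
    filter_upwards [hmarg, h1] with z hz hzi
    have hS := measurableSet_joint_mem hXm z
    have hpos : ∀ᵐ u ∂volume.restrict {u : Euc (Fin a) | joint u z ∈ X}, 0 < p (joint u z) :=
      (ae_restrict_mem hS).mono fun u hu => hp _ hu
    have hnn : 0 ≤ marginalZ X p z := integral_nonneg_of_ae (hpos.mono fun u hu => hu.le)
    rcases hnn.eq_or_lt with h0 | h0
    · -- where the marginal vanishes, the fibre is a null set
      have hz0 := (integral_eq_zero_iff_of_nonneg_ae (hpos.mono fun u hu => hu.le) hzi).1 h0.symm
      have : ∫ u in {u : Euc (Fin a) | joint u z ∈ X},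
          p (joint u z) ^ α * q (joint u z) ^ (1 - α) = 0 := by
        refine integral_eq_zero_of_ae ?_
        filter_upwards [hpos, hz0] with u hu hu0
        exact absurd hu0 hu.ne'
      rw [this, ← h0]
      simp
    · have : ∫ u in {u : Euc (Fin a) | joint u z ∈ X},
          condDensity X p u z ^ α * condDensity X q u z ^ (1 - α) =
          (∫ u in {u : Euc (Fin a) | joint u z ∈ X},
            p (joint u z) ^ α * q (joint u z) ^ (1 - α)) / marginalZ X p z := by
        rw [← integral_div]
        refine setIntegral_congr_fun hS fun u hu => ?_
        simp only [condDensity]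
        rw [← hz, Real.div_rpow (hp _ hu).le h0.le, Real.div_rpow (hq _ hu).le h0.le,
          Real.rpow_sub h0, Real.rpow_one]
        have := (Real.rpow_pos_of_pos h0 α).ne'
        field_simp
      rw [this]
      field_simp
  have h2' : Integrable (marginalZ X p) := h2
  have h3' : ∫ x in X, p x = ∫ z, marginalZ X p z := h3
  rw [condTsallis, integral_congr_ae hae, integral_const_mul, integral_sub h5 h2', ← h6, ← h3',
    hp1, tsallis, powerIntegral]
  have : 1 / (1 - α) = -(1 / (α - 1)) := by
    rw [← neg_sub α 1, one_div_neg_eq_neg_one_div]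
  rw [this]
  ring

end Conditional

lemma BoundedHolderClass.continuousOn {ι : Type} [Fintype ι] {X : Set (Euc ι)} {s L B' B : ℝ}
    {p : Euc ι → ℝ} (hp : p ∈ BoundedHolderClass X s L B' B) : ContinuousOn p X := by
  obtain ⟨⟨F, hF, -⟩, -⟩ := hp
  exact hF.continuousOn

lemma BoundedHolderClass.mem_Icc {ι : Type} [Fintype ι] {X : Set (Euc ι)} {s L B' B : ℝ}
    {p : Euc ι → ℝ} (hp : p ∈ BoundedHolderClass X s L B' B) : ∀ x ∈ X, p x ∈ Set.Icc B' B :=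
  fun x hx => ⟨(hp.2 x hx).1.le, (hp.2 x hx).2.le⟩

end CondTsallis

theorem mainTheorem5 {a b : ℕ} {X : Set (CondTsallis.Euc (Fin a ⊕ Fin b))} (hX : IsCompact X)
    {s L B' B α : ℝ} (hs : ((a + b : ℕ) : ℝ) / 2 < s) (hB' : 0 < B')
    (hα0 : α ≠ 0) (hα1 : α ≠ 1)
    {p q : CondTsallis.Euc (Fin a ⊕ Fin b) → ℝ}
    (hp : p ∈ CondTsallis.BoundedHolderClass X s L B' B)
    (hq : q ∈ CondTsallis.BoundedHolderClass X s L B' B)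
    (hp1 : ∫ x in X, p x = 1) (hq1 : ∫ x in X, q x = 1)
    (hpq : ¬ p =ᵐ[volume.restrict X] q)
    {Ω : Type*} [MeasurableSpace Ω] (P : Measure Ω) [IsProbabilityMeasure P]
    (V W : ℕ → Ω → CondTsallis.Euc (Fin a ⊕ Fin b))
    (hV : ∀ i, HasLaw (V i) (CondTsallis.densityLaw X p) P)
    (hW : ∀ j, HasLaw (W j) (CondTsallis.densityLaw X q) P)
    (hind : iIndepFun (Sum.elim V W) P)
    {ζ : ℝ} (hζ0 : 0 < ζ) (hζ1 : ζ < 1) (n m : ℕ → ℕ)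
    (hn : Tendsto n atTop atTop) (hm : Tendsto m atTop atTop)
    (hnm : Tendsto (fun k => (n k : ℝ) / ((n k : ℝ) + (m k : ℝ))) atTop (𝓝 ζ)) :
    -- the limit is nondegenerate
    0 < CondTsallis.asympVar X α ζ p q ∧
    -- truncated kernel density estimators on a convex domain
    (Convex ℝ X → ∀ (K₁ K₂ : ℝ → CondTsallis.Euc (Fin a ⊕ Fin b) →
        CondTsallis.Euc (Fin a ⊕ Fin b) → ℝ) (h₁ h₂ : ℕ → ℝ),
      CondTsallis.IsSmoothingKernel X s K₁ → CondTsallis.IsSmoothingKernel X s K₂ →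
      (∀ k, 0 < h₁ k) → (∀ k, 0 < h₂ k) →
      (h₁ =Θ[atTop] fun k : ℕ => (k : ℝ) ^ (-1 / (2 * s + ((a + b : ℕ) : ℝ)))) →
      (h₂ =Θ[atTop] fun k : ℕ => (k : ℝ) ^ (-1 / (2 * s + ((a + b : ℕ) : ℝ)))) →
      CondTsallis.DSAsympNormal P V W n m X α ζ p q
        (CondTsallis.truncKDE K₁ h₁ B' B) (CondTsallis.truncKDE K₂ h₂ B' B)) ∧
    -- arbitrary bounded density estimators with the same rate, on any compact domain
    (∀ phat qhat : CondTsallis.DensityEstimator (Fin a ⊕ Fin b),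
      CondTsallis.IsBoundedEstimator X B' B phat → CondTsallis.IsBoundedEstimator X B' B qhat →
      CondTsallis.AttainsRate X s p phat → CondTsallis.AttainsRate X s q qhat →
      CondTsallis.DSAsympNormal P V W n m X α ζ p q phat qhat) ∧
    -- the functional is the conditional divergence when the two laws have a common `Z`-marginal
    ((∀ᵐ z, CondTsallis.marginalZ X p z = CondTsallis.marginalZ X q z) →
      CondTsallis.condTsallis X α p q = CondTsallis.tsallis X α p q) := by
  have hcard : (Fintype.card (Fin a ⊕ Fin b) : ℝ) = ((a + b : ℕ) : ℝ) := by simp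
  have hs' : (Fintype.card (Fin a ⊕ Fin b) : ℝ) / 2 < s := by rwa [hcard]
  have hs0 : 0 < s := lt_of_le_of_lt (by positivity) hs
  have hpc := CondTsallis.BoundedHolderClass.continuousOn hp
  have hqc := CondTsallis.BoundedHolderClass.continuousOn hq
  have hpb := CondTsallis.BoundedHolderClass.mem_Icc hp
  have hqb := CondTsallis.BoundedHolderClass.mem_Icc hq
  have hgeneral : ∀ phat qhat : CondTsallis.DensityEstimator (Fin a ⊕ Fin b),
      CondTsallis.IsBoundedEstimator X B' B phat → CondTsallis.IsBoundedEstimator X B' B qhat →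
      CondTsallis.AttainsRate X s p phat → CondTsallis.AttainsRate X s q qhat →
      CondTsallis.DSAsympNormal P V W n m X α ζ p q phat qhat :=
    fun phat qhat hph hqh hpr hqr =>
      CondTsallis.dsAsympNormal_of_tendsto_mise hB' hα1 hX hpc hqc hpb hqb hp1 hq1 hV hW hind hph
        hqh (CondTsallis.tendsto_sqrt_mul_mise_of_attainsRate hs' hpr)
        (CondTsallis.tendsto_sqrt_mul_mise_of_attainsRate hs' hqr) hζ0 hζ1 hn hm hnm
  refine ⟨CondTsallis.asympVar_pos hB' hα0 hα1 hX hpc hqc hpb hqb hp1 hq1 hpq hζ0 hζ1, ?_,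
    hgeneral, CondTsallis.condTsallis_eq_tsallis hX hα1 hpc hqc
      (fun x hx => hB'.trans_le (hpb x hx).1) (fun x hx => hB'.trans_le (hqb x hx).1) hp1⟩
  intro hXc K₁ K₂ h₁ h₂ hK₁ hK₂ hh₁ hh₂ hΘ₁ hΘ₂
  have hBB : B' ≤ B := by
    rcases X.eq_empty_or_nonempty with rfl | ⟨x, hx⟩
    · simp at hp1
    · exact (hpb x hx).1.trans (hpb x hx).2
  rw [← hcard] at hΘ₁ hΘ₂
  exact hgeneral _ _ (CondTsallis.isBoundedEstimator_truncKDE hBB hK₁ h₁)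
    (CondTsallis.isBoundedEstimator_truncKDE hBB hK₂ h₂)
    (CondTsallis.attainsRate_truncKDE hX hXc hs0 hB' hp hp1 hK₁ hh₁ hΘ₁)
    (CondTsallis.attainsRate_truncKDE hX hXc hs0 hB' hq hq1 hK₂ hh₂ hΘ₂)
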